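/- Let $n\ge 0$ and $\ell\ge 2$ be integers, and let $F(x,y_0,\dots,y_n)$ be a holomorphic function near $0\in\mathbb C^{n+2}$ that does not vanish identically near $0$. Let $$\varphi=\sum_{k=1}^{\infty}c_kx^{\lambda_k},\qquad c_k\in\mathbb C,\quad \lambda_k\in\mathbb R,\quad 0<\lambda_1<\lambda_2<\dots\to+\infty,$$ be a generalized power series with real exponents that formally satisfies the analytic Mahler equation $$F\bigl(x,y(x),y(x^{\ell}),\dots,y(x^{\ell^n})\bigr)=0,$$ that is, substituting $x,\varphi,\mu\varphi,\dots,\mu^n\varphi$, where $\mu^j\varphi=\sum_k c_kx^{\ell^j\lambda_k}$, into the Taylor series of $F$ at $0$ gives a formal series all of whose coefficients are zero. Then there is $r>0$ such that $\varphi$ converges uniformly in every open sector $S$ with vertex $0$, radius at most $r$ and opening less than $2\pi$; here $x^{\lambda_k}=e^{\lambda_k\log x}$ for an arbitrary continuous branch of $\log$ on $S$, and uniform convergence means uniform convergence on $S$ of the partial sums $\sum_{k=1}^{N}c_kx^{\lambda_k}$ as $N\to\infty$. -/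

import Mathlib

open Filter Topology

noncomputable section

/-- A generalized power series `∑ₖ cₖ x ^ λₖ` with real exponents
`0 < λ₀ < λ₁ < … → +∞` and complex coefficients (some or all of which may vanish, so that finite
sums are included). -/
structure GenPowerSeries where
  coeff : ℕ → ℂ
  exponent : ℕ → ℝ
  exponent_zero_pos : 0 < exponent 0
  strictMono_exponent : StrictMono exponent
  tendsto_exponent : Tendsto exponent atTop atTop

namespace GenPowerSeries

/-- The Mahler operator `μ : y(x) ↦ y(x ^ ℓ)`, that is
`∑ₖ cₖ x ^ λₖ ↦ ∑ₖ cₖ x ^ (ℓ λₖ)`. -/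
def mahler (l : ℕ) (hl : 2 ≤ l) (φ : GenPowerSeries) : GenPowerSeries where
  coeff := φ.coeff
  exponent k := l * φ.exponent k
  exponent_zero_pos := mul_pos (by exact_mod_cast (by omega : 0 < l)) φ.exponent_zero_pos
  strictMono_exponent := φ.strictMono_exponent.const_mul (by exact_mod_cast (by omega : 0 < l))
  tendsto_exponent :=
    φ.tendsto_exponent.const_mul_atTop (by exact_mod_cast (by omega : 0 < l))

/-- A generalized power series as an element of the algebra of formal series with well-ordered
real exponents: the coefficient at `λₖ` is `cₖ`, the coefficient at every other real number
is `0`. It carries the usual addition and multiplication of formal series. -/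
def toHahn (φ : GenPowerSeries) : HahnSeries ℝ ℂ :=
  HahnSeries.embDomain (OrderEmbedding.ofStrictMono φ.exponent φ.strictMono_exponent)
    { coeff := φ.coeff, isPWO_support' := (Set.IsWF.of_wellFoundedLT _).isPWO }

theorem toHahn_coeff_exponent (φ : GenPowerSeries) (k : ℕ) :
    φ.toHahn.coeff (φ.exponent k) = φ.coeff k :=
  HahnSeries.embDomain_coeff
    (f := OrderEmbedding.ofStrictMono φ.exponent φ.strictMono_exponent) (a := k)

theorem toHahn_coeff_of_notMem (φ : GenPowerSeries) {t : ℝ} (ht : t ∉ Set.range φ.exponent) :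
    φ.toHahn.coeff t = 0 :=
  HahnSeries.embDomain_of_notMem_range ht

/-- The tuple `(x, φ, μφ, …, μⁿφ)` of formal series. -/
def mahlerTuple (n l : ℕ) (hl : 2 ≤ l) (φ : GenPowerSeries) : Fin (n + 2) → HahnSeries ℝ ℂ :=
  Fin.cons (HahnSeries.single 1 1) fun j : Fin (n + 1) => ((mahler l hl)^[j] φ).toHahn

end GenPowerSeries

/-- The multi-index power series `a` converges to `F` near the origin of `ℂᵐ`: for all `z` in
some polydisc about `0`, `F z = ∑ₚ aₚ z₀ ^ p₀ ⋯ z_{m-1} ^ p_{m-1}` (unconditionally). In other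
words, `F` is holomorphic near `0` and `a` is its Taylor series there. -/
def IsTaylorSeriesAtZero {m : ℕ} (F : (Fin m → ℂ) → ℂ) (a : MvPowerSeries (Fin m) ℂ) : Prop :=
  ∃ r : ℝ, 0 < r ∧ ∀ z : Fin m → ℂ, (∀ i, ‖z i‖ < r) →
    HasSum (fun p : Fin m →₀ ℕ => MvPowerSeries.coeff p a * ∏ i, z i ^ p i) (F z)

/-- The coefficient at `x ^ t` of the formal series obtained by substituting the formal series
`Φ₀, …, Φ_{m-1}` for the variables of the multi-index power series `a`. When all exponents
occurring in the `Φᵢ` are positive, only finitely many terms are nonzero,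
see `finite_support_substCoeff`. -/
def substCoeff {m : ℕ} (a : MvPowerSeries (Fin m) ℂ) (Φ : Fin m → HahnSeries ℝ ℂ) (t : ℝ) : ℂ :=
  ∑ᶠ p : Fin m →₀ ℕ, MvPowerSeries.coeff p a * (∏ i, Φ i ^ p i).coeff t

theorem le_of_mem_support_prod_pow {ι : Type*} (s : Finset ι) (Φ : ι → HahnSeries ℝ ℂ) (ε : ℝ)
    (hΦ : ∀ i, ∀ t ∈ (Φ i).support, ε ≤ t) (p : ι → ℕ) :
    ∀ t ∈ (∏ i ∈ s, Φ i ^ p i).support, ε * (∑ i ∈ s, p i : ℕ) ≤ t := by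
  classical
  have hmul : ∀ (A B : HahnSeries ℝ ℂ) (u v : ℝ), (∀ t ∈ A.support, u ≤ t) →
      (∀ t ∈ B.support, v ≤ t) → ∀ t ∈ (A * B).support, u + v ≤ t := by
    intro A B u v hA hB t ht
    obtain ⟨x, hx, y, hy, rfl⟩ := HahnSeries.support_mul_subset ht
    exact add_le_add (hA x hx) (hB y hy)
  have hone : ∀ t ∈ (1 : HahnSeries ℝ ℂ).support, (0 : ℝ) ≤ t := by
    intro t ht
    rw [HahnSeries.support_one] at ht
    exact (Set.mem_singleton_iff.mp ht).ge
  have hpow : ∀ (i : ι) (k : ℕ), ∀ t ∈ (Φ i ^ k).support, ε * (k : ℝ) ≤ t := by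
    intro i k
    induction k with
    | zero => simp
    | succ k ih =>
      intro t ht
      rw [pow_succ] at ht
      have := hmul _ _ _ _ ih (hΦ i) t ht
      push_cast
      linarith
  induction s using Finset.induction_on with
  | empty => simp
  | insert i s hi ih =>
    intro t ht
    rw [Finset.prod_insert hi] at ht
    have := hmul _ _ _ _ (hpow i (p i)) ih t ht
    rw [Finset.sum_insert hi]
    push_cast at this ⊢
    linarith

/-- Substitution of formal series with positive exponents is well defined. -/
theorem finite_support_substCoeff {m : ℕ} (a : MvPowerSeries (Fin m) ℂ)
    (Φ : Fin m → HahnSeries ℝ ℂ) (hΦ : ∀ i, ∀ t ∈ (Φ i).support, 0 < t) (t : ℝ) :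
    (Function.support fun p : Fin m →₀ ℕ =>
      MvPowerSeries.coeff p a * (∏ i, Φ i ^ p i).coeff t).Finite := by
  have hex : ∀ i, ∃ ε : ℝ, 0 < ε ∧ ∀ t ∈ (Φ i).support, ε ≤ t := by
    intro i
    rcases (Φ i).support.eq_empty_or_nonempty with h | h
    · exact ⟨1, one_pos, by simp [h]⟩
    · exact ⟨(Φ i).isWF_support.min h, hΦ i _ ((Φ i).isWF_support.min_mem h),
        fun t ht => (Φ i).isWF_support.min_le h ht⟩
  choose e he hle using hex
  obtain ⟨ε, hε, hεe⟩ : ∃ ε : ℝ, 0 < ε ∧ ∀ i, ε ≤ e i := by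
    rcases isEmpty_or_nonempty (Fin m) with h | h
    · exact ⟨1, one_pos, fun i => h.elim i⟩
    · obtain ⟨i, hi⟩ := Finite.exists_min e
      exact ⟨e i, he i, hi⟩
  obtain ⟨N, hN⟩ := exists_nat_gt (t / ε)
  refine (Set.finite_Iic (Finsupp.equivFunOnFinite.symm fun _ : Fin m => N)).subset ?_
  intro p hp i
  have hp' : t ∈ (∏ i, Φ i ^ p i).support := fun h0 => hp (by simp [h0])
  have h1 := le_of_mem_support_prod_pow Finset.univ Φ ε
    (fun i t ht => (hεe i).trans (hle i t ht)) p t hp'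
  have h2 : p i ≤ ∑ i, p i := Finset.single_le_sum (fun _ _ => Nat.zero_le _) (Finset.mem_univ i)
  have h3 : ((∑ i, p i : ℕ) : ℝ) < N := by
    refine lt_of_le_of_lt ?_ hN
    rw [le_div_iff₀ hε]
    linarith
  have h4 : (∑ i, p i : ℕ) < N := by exact_mod_cast h3
  exact h2.trans h4.le

theorem pos_of_mem_support_mahlerTuple (n l : ℕ) (hl : 2 ≤ l) (φ : GenPowerSeries)
    (i : Fin (n + 2)) : ∀ t ∈ (φ.mahlerTuple n l hl i).support, 0 < t := by
  have hpos : ∀ ψ : GenPowerSeries, ∀ t ∈ ψ.toHahn.support, 0 < t := by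
    intro ψ t ht
    by_contra h
    refine ht (ψ.toHahn_coeff_of_notMem ?_)
    rintro ⟨k, rfl⟩
    exact h (ψ.exponent_zero_pos.trans_le (ψ.strictMono_exponent.monotone (Nat.zero_le k)))
  refine Fin.cases ?_ (fun j => ?_) i
  · intro t ht
    have := HahnSeries.support_single_subset ht
    rw [Set.mem_singleton_iff.mp this]
    exact one_pos
  · exact hpos _

/-- `φ` formally satisfies the Mahler equation `F(x, y(x), y(x ^ ℓ), …, y(x ^ (ℓ ^ n))) = 0`:
substituting `x, φ, μφ, …, μⁿφ` into the Taylor series of `F` at the origin yields the series all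
of whose coefficients are zero. The variable of `F` with index `0` is `x`, the one with index
`j + 1` is `y_j`. -/
def IsFormalMahlerSolution (n l : ℕ) (hl : 2 ≤ l) (F : (Fin (n + 2) → ℂ) → ℂ)
    (φ : GenPowerSeries) : Prop :=
  ∃ a : MvPowerSeries (Fin (n + 2)) ℂ, IsTaylorSeriesAtZero F a ∧
    ∀ t : ℝ, substCoeff a (φ.mahlerTuple n l hl) t = 0

/-- The open sector with vertex `0`, radius `R` and sides `arg x = α`, `arg x = β`. -/
def openSector (R α β : ℝ) : Set ℂ :=
  {x | ∃ ρ θ : ℝ, 0 < ρ ∧ ρ < R ∧ α < θ ∧ θ < β ∧ x = ρ * Complex.exp (θ * Complex.I)}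

/-- `L` is a (continuous, hence holomorphic) branch of the logarithm on the set `S`. -/
def IsLogBranchOn (L : ℂ → ℂ) (S : Set ℂ) : Prop :=
  ContinuousOn L S ∧ ∀ x ∈ S, Complex.exp (L x) = x

/-- The partial sum of the first `N` terms of `φ` at `x`, where `x ^ λ = exp (λ L(x))` for the
branch `L` of the logarithm. -/
def GenPowerSeries.partialSum (φ : GenPowerSeries) (L : ℂ → ℂ) (N : ℕ) (x : ℂ) : ℂ :=
  ∑ k ∈ Finset.range N, φ.coeff k * Complex.exp (φ.exponent k * L x)

end

open scoped ENNReal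

noncomputable section

/-! The heart of the matter is absolute convergence of `φ` at one positive number, `∑ |c_k| r ^ λ_k
< ∞`. This gives the sectors at once: `|x ^ λ| = |x| ^ λ` for every branch of the logarithm, so the
Weierstrass M-test applies.

Regular case (`exists_absNorm_ne_top_of_regular`): let `b(φ, μφ, …, x) = 0`, and let the derivative
of `b` in the slot of `φ` take a nonzero value `α x ^ v + …` there, the remaining exponents being at
least `v + δ`. Cut `φ` at exponent `t` and expand `b` around the truncated tuple. The tail of `φ`
has order at least `t`, but the tails of `μφ, μ²φ, …` have order at least `2t` because `ℓ ≥ 2`, as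
does the quadratic remainder. Hence `α x ^ v (φ - φ_t)` agrees with `-b(φ_t, …)` up to exponent `v +
δ + t`: the equation determines the coefficients in `[t, t + δ)` from earlier ones
(`single_mul_tail_add_mem_hahnFilt`). Expanding `b(φ_t, …)` around a fixed truncation `φ_s` turns
this into a norm inequality for the window `[s, t + δ)` in terms of `[s, t)`
(`absNorm_window_step`). At a small enough radius it propagates one bound to all windows, so `φ`
converges.

Reduction to the regular case (`exists_absNorm_ne_top`): if some derivative of `b` in the slot of
`φ` does not vanish on the tuple, the last vanishing derivative before the first nonvanishing one is
a regular relation. If all of them vanish, Taylor expansion shows that `b(Y, μφ, …, x)` is zero as a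
series in `Y`, so each coefficient series vanishes at `(μφ, …, x)`. A nonzero one is a relation for
`μφ` with one variable fewer, and `μφ` converges at `r` exactly when `φ` converges at `r ^ ℓ`. With
only `x` left, a nonzero relation is impossible (`not_isFormalZero_single`).

Power series are never evaluated at formal series: polynomial truncations are, with order bounds
growing with the truncation degree and norm bounds independent of it. Norms take values in `[0, ∞]`,
so they can be manipulated before convergence is known. -/

/-- The constant-coefficient algebra structure on formal series, which is to take precedence over
the one through power series. -/
instance hahnSeriesAlgebra : Algebra ℂ (HahnSeries ℝ ℂ) := HahnSeries.instAlgebra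

/-! ### The order filtration on formal series -/

/-- The formal series all of whose exponents are at least `t`. -/
def hahnFilt (t : ℝ) : Submodule ℂ (HahnSeries ℝ ℂ) where
  carrier := {f | ∀ u < t, f.coeff u = 0}
  add_mem' hf hg u hu := by simp [hf u hu, hg u hu]
  zero_mem' u _ := by simp
  smul_mem' c f hf u hu := by simp [hf u hu]

theorem mem_hahnFilt {t : ℝ} {f : HahnSeries ℝ ℂ} :
    f ∈ hahnFilt t ↔ ∀ u < t, f.coeff u = 0 := Iff.rfl

theorem mem_hahnFilt_iff_support {t : ℝ} {f : HahnSeries ℝ ℂ} :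
    f ∈ hahnFilt t ↔ ∀ u ∈ f.support, t ≤ u := by
  refine forall_congr' fun u => ?_
  rw [HahnSeries.mem_support, ← not_lt, not_imp_not]

theorem hahnFilt_anti {s t : ℝ} (h : s ≤ t) : hahnFilt t ≤ hahnFilt s :=
  fun _ hf u hu => hf u (hu.trans_le h)

theorem mul_mem_hahnFilt {s t : ℝ} {f g : HahnSeries ℝ ℂ} (hf : f ∈ hahnFilt s)
    (hg : g ∈ hahnFilt t) : f * g ∈ hahnFilt (s + t) := by
  rw [mem_hahnFilt_iff_support] at *
  intro u hu
  obtain ⟨x, hx, y, hy, rfl⟩ := HahnSeries.support_mul_subset hu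
  exact add_le_add (hf x hx) (hg y hy)

theorem mul_mem_hahnFilt_of_left {s : ℝ} {f g : HahnSeries ℝ ℂ} (hf : f ∈ hahnFilt s)
    (hg : g ∈ hahnFilt 0) : f * g ∈ hahnFilt s := by
  simpa using mul_mem_hahnFilt hf hg

theorem single_mem_hahnFilt (t : ℝ) (c : ℂ) : HahnSeries.single t c ∈ hahnFilt t :=
  fun _ hu => HahnSeries.coeff_single_of_ne hu.ne

theorem algebraMap_mem_hahnFilt (c : ℂ) : algebraMap ℂ (HahnSeries ℝ ℂ) c ∈ hahnFilt 0 := by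
  rw [HahnSeries.algebraMap_apply]
  exact single_mem_hahnFilt 0 _

theorem pow_mem_hahnFilt {ε : ℝ} {f : HahnSeries ℝ ℂ} (hf : f ∈ hahnFilt ε) (k : ℕ) :
    f ^ k ∈ hahnFilt (ε * k) := by
  induction k with
  | zero => simpa using algebraMap_mem_hahnFilt 1
  | succ k ih =>
    rw [pow_succ]
    convert mul_mem_hahnFilt ih hf using 1
    push_cast
    ring_nf

theorem aeval_mem_hahnFilt {ι : Type*} {z : ι → HahnSeries ℝ ℂ} (hz : ∀ i, z i ∈ hahnFilt 0)
    (g : MvPolynomial ι ℂ) : MvPolynomial.aeval z g ∈ hahnFilt 0 := by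
  induction g using MvPolynomial.induction_on with
  | C a => simpa using algebraMap_mem_hahnFilt a
  | add p q hp hq => simpa using add_mem hp hq
  | mul_X p i hp => simpa using mul_mem_hahnFilt_of_left hp (hz i)

theorem aeval_mem_hahnFilt_of_degree {ι : Type*} [Fintype ι] {z : ι → HahnSeries ℝ ℂ} {ε : ℝ}
    (hε : 0 ≤ ε) (hz : ∀ i, z i ∈ hahnFilt ε) (g : MvPolynomial ι ℂ) (K : ℕ)
    (hg : ∀ p, p.degree < K → g.coeff p = 0) :
    MvPolynomial.aeval z g ∈ hahnFilt (ε * K) := by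
  rw [MvPolynomial.aeval_def, MvPolynomial.eval₂_eq']
  refine sum_mem fun p hp => ?_
  rw [← Algebra.smul_def]
  refine Submodule.smul_mem _ _ (hahnFilt_anti (t := ε * p.degree) ?_ ?_)
  · have : K ≤ p.degree := by
      by_contra h
      exact (MvPolynomial.mem_support_iff.1 hp) (hg p (by omega))
    gcongr
  · rw [mem_hahnFilt_iff_support, Finsupp.degree_eq_sum]
    exact le_of_mem_support_prod_pow Finset.univ z ε
      (fun i => mem_hahnFilt_iff_support.1 (hz i)) p

/-! ### Second order Taylor expansion of polynomials -/

section Taylor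

variable {ι R : Type*} [Fintype ι] [CommRing R] [Algebra ℂ R]

/-- The first order part of `aeval (z + h) g - aeval z g`. -/
def linearPart (z h : ι → R) (g : MvPolynomial ι ℂ) : R :=
  ∑ j, h j * MvPolynomial.aeval z (MvPolynomial.pderiv j g)

/-- The second order remainder of the Taylor expansion of `aeval (z + h) g` at `z`. -/
def taylorRem (z h : ι → R) (g : MvPolynomial ι ℂ) : R :=
  MvPolynomial.aeval (z + h) g - MvPolynomial.aeval z g - linearPart z h g

theorem linearPart_add (z h : ι → R) (f g : MvPolynomial ι ℂ) :
    linearPart z h (f + g) = linearPart z h f + linearPart z h g := by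
  simp [linearPart, mul_add, Finset.sum_add_distrib]

theorem linearPart_smul (z h : ι → R) (c : ℂ) (g : MvPolynomial ι ℂ) :
    linearPart z h (c • g) = c • linearPart z h g := by
  simp [linearPart, Finset.smul_sum]

theorem taylorRem_add (z h : ι → R) (f g : MvPolynomial ι ℂ) :
    taylorRem z h (f + g) = taylorRem z h f + taylorRem z h g := by
  simp only [taylorRem, linearPart_add, map_add]
  ring

theorem taylorRem_smul (z h : ι → R) (c : ℂ) (g : MvPolynomial ι ℂ) :
    taylorRem z h (c • g) = c • taylorRem z h g := by
  simp only [taylorRem, linearPart_smul, map_smul, smul_sub]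

theorem linearPart_C (z h : ι → R) (c : ℂ) : linearPart z h (MvPolynomial.C c) = 0 := by
  simp [linearPart]

theorem taylorRem_C (z h : ι → R) (c : ℂ) : taylorRem z h (MvPolynomial.C c) = 0 := by
  simp [taylorRem, linearPart_C]

theorem linearPart_mul_X (z h : ι → R) (g : MvPolynomial ι ℂ) (i : ι) :
    linearPart z h (g * MvPolynomial.X i) =
      linearPart z h g * z i + h i * MvPolynomial.aeval z g := by
  classical
  have : ∀ j, h j * MvPolynomial.aeval z (MvPolynomial.pderiv j (g * MvPolynomial.X i)) =
      h j * MvPolynomial.aeval z (MvPolynomial.pderiv j g) * z i +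
        (if i = j then h i * MvPolynomial.aeval z g else 0) := by
    intro j
    rw [MvPolynomial.pderiv_mul, MvPolynomial.pderiv_X]
    by_cases hij : i = j
    · subst hij
      simp
      ring
    · simp [hij]
      ring
  rw [linearPart, Finset.sum_congr rfl fun j _ => this j, Finset.sum_add_distrib, linearPart,
    Finset.sum_mul, Finset.sum_ite_eq]
  simp

/-- This recursion carries both the order and the norm estimate of the remainder: each summand is
visibly of second order in `h`, so no explicit formula for the remainder is needed. -/
theorem taylorRem_mul_X (z h : ι → R) (g : MvPolynomial ι ℂ) (i : ι) :
    taylorRem z h (g * MvPolynomial.X i) =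
      h i * linearPart z h g + taylorRem z h g * (z i + h i) := by
  simp only [taylorRem, linearPart_mul_X, map_mul, MvPolynomial.aeval_X, Pi.add_apply]
  ring

theorem aeval_add_eq (z h : ι → R) (g : MvPolynomial ι ℂ) :
    MvPolynomial.aeval (z + h) g =
      MvPolynomial.aeval z g + linearPart z h g + taylorRem z h g := by
  rw [taylorRem]
  ring

end Taylor

section TaylorFilt

variable {ι : Type*} [Fintype ι] {z h : ι → HahnSeries ℝ ℂ} {t : ℝ}

theorem linearPart_mem_hahnFilt (hz : ∀ i, z i ∈ hahnFilt 0) (hh : ∀ i, h i ∈ hahnFilt t)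
    (g : MvPolynomial ι ℂ) : linearPart z h g ∈ hahnFilt t :=
  sum_mem fun i _ => mul_mem_hahnFilt_of_left (hh i) (aeval_mem_hahnFilt hz _)

theorem taylorRem_mem_hahnFilt (ht : 0 ≤ t) (hz : ∀ i, z i ∈ hahnFilt 0)
    (hh : ∀ i, h i ∈ hahnFilt t) (g : MvPolynomial ι ℂ) : taylorRem z h g ∈ hahnFilt (t + t) := by
  induction g using MvPolynomial.induction_on with
  | C a => simp [taylorRem_C]
  | add p q hp hq =>
    rw [taylorRem_add]
    exact add_mem hp hq
  | mul_X p i hp =>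
    rw [taylorRem_mul_X]
    exact add_mem (mul_mem_hahnFilt (hh i) (linearPart_mem_hahnFilt hz hh p))
      (mul_mem_hahnFilt_of_left hp (add_mem (hz i) (hahnFilt_anti ht (hh i))))

theorem aeval_add_sub_mem_hahnFilt (ht : 0 ≤ t) (hz : ∀ i, z i ∈ hahnFilt 0)
    (hh : ∀ i, h i ∈ hahnFilt t) (g : MvPolynomial ι ℂ) :
    MvPolynomial.aeval (z + h) g - MvPolynomial.aeval z g ∈ hahnFilt t := by
  rw [aeval_add_eq, add_assoc, add_sub_cancel_left]
  exact add_mem (linearPart_mem_hahnFilt hz hh g)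
    (hahnFilt_anti (by linarith) (taylorRem_mem_hahnFilt ht hz hh g))

end TaylorFilt

/-! ### The weighted norm and its submultiplicativity -/

/-- The weighted `ℓ¹` norm `∑ₜ |fₜ| r ^ t` of a formal series. -/
def hahnNorm (r : ℝ≥0∞) (f : HahnSeries ℝ ℂ) : ℝ≥0∞ :=
  ∑' t : ℝ, ‖f.coeff t‖ₑ * r ^ t

theorem hahnNorm_zero (r : ℝ≥0∞) : hahnNorm r 0 = 0 := by simp [hahnNorm]

theorem hahnNorm_neg (r : ℝ≥0∞) (f : HahnSeries ℝ ℂ) : hahnNorm r (-f) = hahnNorm r f := by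
  simp [hahnNorm]

theorem hahnNorm_add_le (r : ℝ≥0∞) (f g : HahnSeries ℝ ℂ) :
    hahnNorm r (f + g) ≤ hahnNorm r f + hahnNorm r g := by
  rw [hahnNorm, hahnNorm, hahnNorm, ← ENNReal.tsum_add]
  refine ENNReal.tsum_le_tsum fun t => ?_
  rw [← add_mul]
  gcongr
  exact enorm_add_le _ _

theorem hahnNorm_sub_le (r : ℝ≥0∞) (f g : HahnSeries ℝ ℂ) :
    hahnNorm r (f - g) ≤ hahnNorm r f + hahnNorm r g := by
  rw [sub_eq_add_neg, ← hahnNorm_neg r g]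
  exact hahnNorm_add_le _ _ _

theorem hahnNorm_sum_le {κ : Type*} (r : ℝ≥0∞) (s : Finset κ) (f : κ → HahnSeries ℝ ℂ) :
    hahnNorm r (∑ i ∈ s, f i) ≤ ∑ i ∈ s, hahnNorm r (f i) :=
  Finset.le_sum_of_subadditive _ (hahnNorm_zero r).le (hahnNorm_add_le r) s f

theorem hahnNorm_smul (r : ℝ≥0∞) (c : ℂ) (f : HahnSeries ℝ ℂ) :
    hahnNorm r (c • f) = ‖c‖ₑ * hahnNorm r f := by
  simp [hahnNorm, mul_assoc, ENNReal.tsum_mul_left]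

theorem hahnNorm_single (r : ℝ≥0∞) (t : ℝ) (c : ℂ) :
    hahnNorm r (HahnSeries.single t c) = ‖c‖ₑ * r ^ t := by
  rw [hahnNorm, tsum_eq_single t]
  · simp
  · intro u hu
    simp [HahnSeries.coeff_single_of_ne hu]

/-- The Cauchy product estimate. A pair of exponents with sum `t` is determined by its first entry,
so the sum over the antidiagonal is dominated by a convolution over all of `ℝ`, and the order of
summation can be exchanged. -/
theorem hahnNorm_mul_le {r : ℝ≥0∞} (h0 : r ≠ 0) (h1 : r ≠ ⊤) (f g : HahnSeries ℝ ℂ) :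
    hahnNorm r (f * g) ≤ hahnNorm r f * hahnNorm r g := by
  set F : ℝ → ℝ≥0∞ := fun t => ‖f.coeff t‖ₑ * r ^ t
  set G : ℝ → ℝ≥0∞ := fun t => ‖g.coeff t‖ₑ * r ^ t
  have hterm : ∀ t, ‖(f * g).coeff t‖ₑ * r ^ t ≤ ∑' u, F u * G (t - u) := by
    intro t
    rw [HahnSeries.coeff_mul]
    set s := Finset.antidiagonal f.isPWO_support g.isPWO_support t
    have hinj : Set.InjOn Prod.fst (s : Set (ℝ × ℝ)) := by
      intro a ha b hb hab
      have h1 := (Finset.mem_antidiagonal.1 ha).2.2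
      have h2 := (Finset.mem_antidiagonal.1 hb).2.2
      exact Prod.ext hab (by linarith)
    calc ‖∑ ij ∈ s, f.coeff ij.1 * g.coeff ij.2‖ₑ * r ^ t
        ≤ (∑ ij ∈ s, ‖f.coeff ij.1 * g.coeff ij.2‖ₑ) * r ^ t := by
          gcongr
          exact enorm_sum_le _ _
      _ = ∑ ij ∈ s, F ij.1 * G (t - ij.1) := by
          rw [Finset.sum_mul]
          refine Finset.sum_congr rfl fun ij hij => ?_
          have h2 := (Finset.mem_antidiagonal.1 hij).2.2
          have h3 : t - ij.1 = ij.2 := by linarith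
          rw [h3, ← h2, ENNReal.rpow_add _ _ h0 h1, enorm_mul]
          simp only [F, G]
          ring
      _ = ∑ u ∈ s.image Prod.fst, F u * G (t - u) := by
          rw [Finset.sum_image hinj]
      _ ≤ _ := ENNReal.sum_le_tsum _
  calc hahnNorm r (f * g) ≤ ∑' t, ∑' u, F u * G (t - u) := ENNReal.tsum_le_tsum hterm
    _ = ∑' u, ∑' t, F u * G (t - u) := ENNReal.tsum_comm
    _ = ∑' u, F u * ∑' t, G t := by
        refine tsum_congr fun u => ?_
        rw [ENNReal.tsum_mul_left]
        congr 1
        exact (Equiv.subRight u).tsum_eq G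
    _ = hahnNorm r f * hahnNorm r g := ENNReal.tsum_mul_right

/-- This converts order into smallness: shrinking the radius by `σ` gains `σ ^ u` on series of order
at least `u`. -/
theorem hahnNorm_le_rpow_mul {σ r : ℝ≥0∞} (hσ : σ ≤ 1) {u : ℝ} {f : HahnSeries ℝ ℂ}
    (hu : 0 ≤ u) (hf : f ∈ hahnFilt u) :
    hahnNorm (σ * r) f ≤ σ ^ u * hahnNorm r f := by
  rw [hahnNorm, hahnNorm, ← ENNReal.tsum_mul_left]
  refine ENNReal.tsum_le_tsum fun t => ?_
  rcases lt_or_ge t u with ht | ht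
  · simp [hf t ht]
  · rw [ENNReal.mul_rpow_of_nonneg _ _ (hu.trans ht), mul_left_comm]
    gcongr ?_ * _
    exact ENNReal.rpow_le_rpow_of_exponent_ge hσ ht

theorem Finsupp.induction_add_single_one {ι : Type*} {P : (ι →₀ ℕ) → Prop} (zero : P 0)
    (add : ∀ p i, P p → P (p + Finsupp.single i 1)) (p : ι →₀ ℕ) : P p := by
  generalize hn : p.degree = n
  induction n generalizing p with
  | zero => rwa [(Finsupp.degree_eq_zero_iff p).1 hn]
  | succ n ih =>
    obtain ⟨i, hi⟩ : ∃ i, p i ≠ 0 := by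
      by_contra! h
      simp [show p = 0 from Finsupp.ext h] at hn
    have hle : Finsupp.single i 1 ≤ p := Finsupp.single_le_iff.2 (Nat.one_le_iff_ne_zero.2 hi)
    rw [← tsub_add_cancel_of_le hle] at hn ⊢
    refine add _ _ (ih _ ?_)
    simpa using hn

/-! ### Norm bounds on monomials -/

section NormBounds

variable {ι : Type*} {r ρ M : ℝ≥0∞} {z h : ι → HahnSeries ℝ ℂ}

theorem hahnNorm_aeval_monomial_le (h0 : r ≠ 0) (h1 : r ≠ ⊤) (hz : ∀ i, hahnNorm r (z i) ≤ ρ)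
    (p : ι →₀ ℕ) :
    hahnNorm r (MvPolynomial.aeval z (MvPolynomial.monomial p (1 : ℂ))) ≤ ρ ^ p.degree := by
  induction p using Finsupp.induction_add_single_one with
  | zero =>
    have := hahnNorm_single r 0 1
    simp_all
  | add p i ih =>
    rw [MvPolynomial.monomial_add_single, pow_one, map_mul, MvPolynomial.aeval_X, map_add,
      Finsupp.degree_single, pow_succ]
    exact (hahnNorm_mul_le h0 h1 _ _).trans (mul_le_mul' ih (hz i))

/-- The factor `ρ` on the left restores the degree lost by differentiating, which avoids the
exponent `p.degree - 1`. -/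
theorem hahnNorm_aeval_pderiv_monomial_le (h0 : r ≠ 0) (h1 : r ≠ ⊤)
    (hz : ∀ i, hahnNorm r (z i) ≤ ρ) (j : ι) (p : ι →₀ ℕ) :
    hahnNorm r (MvPolynomial.aeval z (MvPolynomial.pderiv j (MvPolynomial.monomial p (1 : ℂ)))) * ρ
      ≤ p.degree * ρ ^ p.degree := by
  rw [MvPolynomial.pderiv_monomial, one_mul]
  rcases Nat.eq_zero_or_pos (p j) with hj | hj
  · simp [hj, hahnNorm_zero]
  have hle : Finsupp.single j 1 ≤ p := Finsupp.single_le_iff.2 hj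
  have hdeg : p.degree = (p - Finsupp.single j 1).degree + 1 := by
    conv_lhs => rw [← tsub_add_cancel_of_le hle]
    simp
  have hmon : MvPolynomial.monomial (p - Finsupp.single j 1) (p j : ℂ) =
      (p j : ℂ) • MvPolynomial.monomial (p - Finsupp.single j 1) (1 : ℂ) := by
    simp [MvPolynomial.smul_monomial]
  rw [hmon, map_smul, hahnNorm_smul, mul_assoc]
  have hnorm : ‖(p j : ℂ)‖ₑ = (p j : ℝ≥0∞) := by
    rw [← ofReal_norm, Complex.norm_natCast, ENNReal.ofReal_natCast]
  rw [hnorm]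
  gcongr
  · exact_mod_cast Finsupp.le_degree j p
  · rw [hdeg, pow_succ]
    gcongr
    exact hahnNorm_aeval_monomial_le h0 h1 hz _

variable [Fintype ι]

theorem hahnNorm_linearPart_monomial_le (h0 : r ≠ 0) (h1 : r ≠ ⊤)
    (hz : ∀ i, hahnNorm r (z i) ≤ ρ) (hh : ∀ i, hahnNorm r (h i) ≤ ρ * M) (p : ι →₀ ℕ) :
    hahnNorm r (linearPart z h (MvPolynomial.monomial p (1 : ℂ))) ≤
      p.degree * ρ ^ p.degree * M := by
  induction p using Finsupp.induction_add_single_one with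
  | zero =>
    rw [← MvPolynomial.C_apply, linearPart_C]
    simp [hahnNorm_zero]
  | add p i ih =>
    rw [MvPolynomial.monomial_add_single, pow_one, linearPart_mul_X, map_add,
      Finsupp.degree_single]
    calc _ ≤ _ := hahnNorm_add_le _ _ _
      _ ≤ p.degree * ρ ^ p.degree * M * ρ + ρ * M * ρ ^ p.degree := by
        gcongr
        · exact (hahnNorm_mul_le h0 h1 _ _).trans (mul_le_mul' ih (hz i))
        · exact (hahnNorm_mul_le h0 h1 _ _).trans
            (mul_le_mul' (hh i) (hahnNorm_aeval_monomial_le h0 h1 hz p))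
      _ = _ := by
        push_cast
        ring

/-- In the recursion for multiplication by a variable, the coefficient passes from `d ^ 2` to `d + d
^ 2`, which is at most `(d + 1) ^ 2`. -/
theorem hahnNorm_taylorRem_monomial_le (h0 : r ≠ 0) (h1 : r ≠ ⊤)
    (hz : ∀ i, hahnNorm r (z i) ≤ ρ) (hzh : ∀ i, hahnNorm r (z i + h i) ≤ ρ)
    (hh : ∀ i, hahnNorm r (h i) ≤ ρ * M) (p : ι →₀ ℕ) :
    hahnNorm r (taylorRem z h (MvPolynomial.monomial p (1 : ℂ))) ≤
      p.degree ^ 2 * ρ ^ p.degree * M ^ 2 := by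
  induction p using Finsupp.induction_add_single_one with
  | zero =>
    rw [← MvPolynomial.C_apply, taylorRem_C]
    simp [hahnNorm_zero]
  | add p i ih =>
    rw [MvPolynomial.monomial_add_single, pow_one, taylorRem_mul_X, map_add,
      Finsupp.degree_single]
    calc _ ≤ _ := hahnNorm_add_le _ _ _
      _ ≤ ρ * M * (p.degree * ρ ^ p.degree * M) + p.degree ^ 2 * ρ ^ p.degree * M ^ 2 * ρ := by
        gcongr
        · exact (hahnNorm_mul_le h0 h1 _ _).trans
            (mul_le_mul' (hh i) (hahnNorm_linearPart_monomial_le h0 h1 hz hh p))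
        · exact (hahnNorm_mul_le h0 h1 _ _).trans (mul_le_mul' ih (hzh i))
      _ = (p.degree + p.degree ^ 2) * ρ ^ (p.degree + 1) * M ^ 2 := by ring
      _ ≤ _ := by
        gcongr
        norm_cast
        nlinarith

end NormBounds

/-! ### Norm bounds on truncated power series, uniform in the truncation -/

section Series

variable {ι : Type*}

/-- The sum `∑ₚ |bₚ| ρ ^ |p|`. -/
def absSum (b : MvPowerSeries ι ℂ) (ρ : ℝ≥0∞) : ℝ≥0∞ :=
  ∑' p : ι →₀ ℕ, ‖MvPowerSeries.coeff p b‖ₑ * ρ ^ p.degree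

variable [Fintype ι]

/-- The right-hand side does not involve `K`; this is the source of all bounds uniform in the
truncation degree. -/
theorem hahnNorm_map_truncTotal_le (r : ℝ≥0∞) (T : MvPolynomial ι ℂ →ₗ[ℂ] HahnSeries ℝ ℂ)
    (b : MvPowerSeries ι ℂ) (K : ℕ) :
    hahnNorm r (T (b.truncTotal K)) ≤
      ∑' p : ι →₀ ℕ, ‖MvPowerSeries.coeff p b‖ₑ * hahnNorm r (T (MvPolynomial.monomial p 1)) := by
  set g := b.truncTotal K
  have hg : T g = ∑ p ∈ g.support, g.coeff p • T (MvPolynomial.monomial p 1) := by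
    conv_lhs => rw [g.as_sum, map_sum]
    refine Finset.sum_congr rfl fun p _ => ?_
    rw [← map_smul, MvPolynomial.smul_monomial, smul_eq_mul, mul_one]
  rw [hg]
  refine (hahnNorm_sum_le _ _ _).trans (le_trans (Finset.sum_le_sum fun p hp => ?_)
    (ENNReal.sum_le_tsum g.support))
  rw [hahnNorm_smul]
  gcongr
  simp only [g, MvPowerSeries.coeff_truncTotal_eq_ite]
  split_ifs <;> simp

variable {r ρ M : ℝ≥0∞} {z h : ι → HahnSeries ℝ ℂ}

theorem hahnNorm_aeval_truncTotal_le (h0 : r ≠ 0) (h1 : r ≠ ⊤) (hz : ∀ i, hahnNorm r (z i) ≤ ρ)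
    (b : MvPowerSeries ι ℂ) (K : ℕ) :
    hahnNorm r (MvPolynomial.aeval z (b.truncTotal K)) ≤ absSum b ρ :=
  (hahnNorm_map_truncTotal_le r (MvPolynomial.aeval z).toLinearMap b K).trans
    (ENNReal.tsum_le_tsum fun p => mul_le_mul_right (hahnNorm_aeval_monomial_le h0 h1 hz p) _)

theorem hahnNorm_aeval_pderiv_truncTotal_le (h0 : r ≠ 0) (h1 : r ≠ ⊤)
    (hz : ∀ i, hahnNorm r (z i) ≤ ρ) (j : ι) (b : MvPowerSeries ι ℂ) (K : ℕ) :
    hahnNorm r (MvPolynomial.aeval z (MvPolynomial.pderiv j (b.truncTotal K))) * ρ ≤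
      absSum b (2 * ρ) := by
  refine (mul_le_mul_left (hahnNorm_map_truncTotal_le r ((MvPolynomial.aeval z).toLinearMap ∘ₗ
    (MvPolynomial.pderiv j).toLinearMap) b K) _).trans ?_
  rw [← ENNReal.tsum_mul_right]
  refine ENNReal.tsum_le_tsum fun p => ?_
  rw [mul_assoc]
  gcongr
  refine (hahnNorm_aeval_pderiv_monomial_le h0 h1 hz j p).trans ?_
  rw [mul_pow]
  gcongr
  exact_mod_cast Nat.lt_two_pow_self.le

/-- The polynomial loss `d ^ 2` on monomials of degree `d` is absorbed by `4 ^ d`, that is, by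
passing from radius `ρ` to `4 * ρ`. -/
theorem hahnNorm_taylorRem_truncTotal_le (h0 : r ≠ 0) (h1 : r ≠ ⊤)
    (hz : ∀ i, hahnNorm r (z i) ≤ ρ) (hzh : ∀ i, hahnNorm r (z i + h i) ≤ ρ)
    (hh : ∀ i, hahnNorm r (h i) ≤ ρ * M) (b : MvPowerSeries ι ℂ) (K : ℕ) :
    hahnNorm r (taylorRem z h (b.truncTotal K)) ≤ absSum b (4 * ρ) * M ^ 2 := by
  refine (hahnNorm_map_truncTotal_le r
    (IsLinearMap.mk' (taylorRem z h) ⟨taylorRem_add z h, taylorRem_smul z h⟩) b K).trans ?_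
  rw [absSum, ← ENNReal.tsum_mul_right]
  refine ENNReal.tsum_le_tsum fun p => ?_
  rw [mul_assoc]
  gcongr
  refine (hahnNorm_taylorRem_monomial_le h0 h1 hz hzh hh p).trans ?_
  have hpow : (p.degree : ℝ≥0∞) ^ 2 ≤ 4 ^ p.degree := by
    rw [show (4 : ℝ≥0∞) = 2 ^ 2 by norm_num, pow_right_comm]
    exact pow_le_pow_left₀ zero_le (by exact_mod_cast Nat.lt_two_pow_self.le) 2
  rw [mul_pow]
  gcongr

/-- A Cauchy estimate on coefficients: the factor produced by differentiation is at most `2 ^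
(p.degree + 1)`, which doubling the radius pays for. -/
theorem absSum_pderiv_ne_top {ι : Type*} {b : MvPowerSeries ι ℂ} (hρ : ρ ≠ 0)
    (hb : absSum b (2 * ρ) ≠ ⊤) (j : ι) : absSum (MvPowerSeries.pderiv ℂ j b) ρ ≠ ⊤ := by
  have key : absSum (MvPowerSeries.pderiv ℂ j b) ρ * ρ ≤ absSum b (2 * ρ) := by
    rw [absSum, ← ENNReal.tsum_mul_right]
    refine le_trans (ENNReal.tsum_le_tsum fun p => ?_)
      (ENNReal.tsum_comp_le_tsum_of_injective (add_left_injective (Finsupp.single j 1)) _)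
    rw [MvPowerSeries.coeff_pderiv, enorm_mul, map_add, Finsupp.degree_single, mul_assoc,
      mul_assoc, ← pow_succ, mul_pow]
    have hnorm : ‖(p j : ℂ) + 1‖ₑ = ((p j + 1 : ℕ) : ℝ≥0∞) := by
      rw [← ofReal_norm, ← Nat.cast_succ, Complex.norm_natCast, ENNReal.ofReal_natCast]
    rw [hnorm]
    gcongr
    have h1 : p j + 1 ≤ 2 ^ (p.degree + 1) :=
      (Nat.succ_le_succ (Finsupp.le_degree j p)).trans Nat.lt_two_pow_self.le
    exact_mod_cast h1
  intro htop
  rw [htop, ENNReal.top_mul hρ, top_le_iff] at key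
  exact hb key

end Series

/-! ### Tuples of Mahler iterates -/

namespace GenPowerSeries

/-- The series with the same exponents as `φ` and coefficients `c`. -/
def withCoeff (φ : GenPowerSeries) (c : ℕ → ℂ) : GenPowerSeries := { φ with coeff := c }

theorem toHahn_withCoeff_sub (φ : GenPowerSeries) (c d : ℕ → ℂ) :
    (φ.withCoeff c).toHahn - (φ.withCoeff d).toHahn = (φ.withCoeff (c - d)).toHahn := by
  ext t
  rw [HahnSeries.coeff_sub]
  by_cases ht : t ∈ Set.range φ.exponent
  · obtain ⟨k, rfl⟩ := ht
    have h := fun c => (φ.withCoeff c).toHahn_coeff_exponent k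
    simp only [withCoeff] at h ⊢
    simp [h]
  · have h := fun c => (φ.withCoeff c).toHahn_coeff_of_notMem (t := t) ht
    simp [h]

theorem toHahn_mem_hahnFilt {φ : GenPowerSeries} {t : ℝ}
    (h : ∀ k, φ.exponent k < t → φ.coeff k = 0) : φ.toHahn ∈ hahnFilt t := by
  intro u hu
  by_cases hu' : u ∈ Set.range φ.exponent
  · obtain ⟨k, rfl⟩ := hu'
    rw [toHahn_coeff_exponent, h k hu]
  · exact toHahn_coeff_of_notMem _ hu'

/-- The sum `∑ₖ |cₖ| r ^ λₖ`. -/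
def absNorm (φ : GenPowerSeries) (r : ℝ≥0∞) : ℝ≥0∞ := ∑' k, ‖φ.coeff k‖ₑ * r ^ φ.exponent k

theorem hahnNorm_toHahn (φ : GenPowerSeries) (r : ℝ≥0∞) :
    hahnNorm r φ.toHahn = φ.absNorm r := by
  rw [hahnNorm, absNorm, ← φ.strictMono_exponent.injective.tsum_eq]
  · simp_rw [toHahn_coeff_exponent]
  · intro t ht
    by_contra h
    simp [toHahn_coeff_of_notMem _ h] at ht

theorem exponent_pos (φ : GenPowerSeries) (k : ℕ) : 0 < φ.exponent k :=
  φ.exponent_zero_pos.trans_le (φ.strictMono_exponent.monotone (Nat.zero_le k))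

theorem two_mul_exponent_le_mahler (φ : GenPowerSeries) {l : ℕ} (hl : 2 ≤ l) (k : ℕ) :
    2 * φ.exponent k ≤ (φ.mahler l hl).exponent k := by
  have h1 : (2 : ℝ) ≤ l := by exact_mod_cast hl
  exact mul_le_mul_of_nonneg_right h1 (φ.exponent_pos k).le

theorem absNorm_mahler_le (φ : GenPowerSeries) {l : ℕ} (hl : 2 ≤ l) {r : ℝ≥0∞} (hr : r ≤ 1) :
    (φ.mahler l hl).absNorm r ≤ φ.absNorm r := by
  refine ENNReal.tsum_le_tsum fun k => mul_le_mul_right ?_ _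
  refine ENNReal.rpow_le_rpow_of_exponent_ge hr ?_
  linarith [φ.two_mul_exponent_le_mahler hl k, φ.exponent_pos k]

/-- For an exponent `λ ≥ t` one has `ℓ λ ≥ 2 λ ≥ t + λ`, so the Mahler operator gains a factor `r ^
t`. -/
theorem absNorm_mahler_le_rpow_mul {φ : GenPowerSeries} {l : ℕ} (hl : 2 ≤ l) {r : ℝ≥0∞}
    (h0 : r ≠ 0) (hr : r ≤ 1) {t : ℝ} (h : ∀ k, φ.exponent k < t → φ.coeff k = 0) :
    (φ.mahler l hl).absNorm r ≤ r ^ t * φ.absNorm r := by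
  rw [absNorm, absNorm, ← ENNReal.tsum_mul_left]
  refine ENNReal.tsum_le_tsum fun k => ?_
  rcases lt_or_ge (φ.exponent k) t with hk | hk
  · simp [mahler, h k hk]
  · rw [mul_left_comm, ← ENNReal.rpow_add _ _ h0 (ne_top_of_le_ne_top ENNReal.one_ne_top hr)]
    refine mul_le_mul_right (ENNReal.rpow_le_rpow_of_exponent_ge hr ?_) _
    linarith [φ.two_mul_exponent_le_mahler hl k]

/-- The tuple `(φ, μφ, …, μ^(m-1) φ, x)` of formal series. -/
def hahnTuple (l : ℕ) (hl : 2 ≤ l) : (m : ℕ) → GenPowerSeries → Fin (m + 1) → HahnSeries ℝ ℂ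
  | 0, _ => fun _ => HahnSeries.single 1 1
  | m + 1, φ => Fin.cons φ.toHahn (hahnTuple l hl m (φ.mahler l hl))

variable {l : ℕ} (hl : 2 ≤ l)

theorem hahnTuple_mem_hahnFilt {ε : ℝ} (hε : ε ≤ 1) (m : ℕ) (φ : GenPowerSeries)
    (h : ε ≤ φ.exponent 0) (i : Fin (m + 1)) : hahnTuple l hl m φ i ∈ hahnFilt ε := by
  induction m generalizing φ with
  | zero => exact hahnFilt_anti hε (single_mem_hahnFilt 1 1)
  | succ m ih =>
    refine Fin.cases ?_ (fun j => ?_) i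
    · refine toHahn_mem_hahnFilt fun k hk => absurd hk (not_lt.2 (h.trans ?_))
      exact φ.strictMono_exponent.monotone (Nat.zero_le k)
    · refine ih (φ.mahler l hl) ?_ j
      linarith [φ.two_mul_exponent_le_mahler hl 0, φ.exponent_pos 0]

theorem hahnTuple_mem_hahnFilt_zero (m : ℕ) (φ : GenPowerSeries) (i : Fin (m + 1)) :
    hahnTuple l hl m φ i ∈ hahnFilt 0 :=
  hahnTuple_mem_hahnFilt hl zero_le_one m φ φ.exponent_zero_pos.le i

theorem hahnNorm_hahnTuple_le {r ρ : ℝ≥0∞} (hr : r ≤ 1) (hrρ : r ≤ ρ) (m : ℕ)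
    (φ : GenPowerSeries) (h : φ.absNorm r ≤ ρ) (i : Fin (m + 1)) :
    hahnNorm r (hahnTuple l hl m φ i) ≤ ρ := by
  induction m generalizing φ with
  | zero =>
    rw [hahnTuple, hahnNorm_single]
    simpa using hrρ
  | succ m ih =>
    refine Fin.cases ?_ (fun j => ?_) i
    · rw [hahnTuple, Fin.cons_zero, hahnNorm_toHahn]
      exact h
    · exact ih (φ.mahler l hl) ((φ.absNorm_mahler_le hl hr).trans h) j

theorem hahnTuple_sub_mem_hahnFilt {t : ℝ} (ht : 0 ≤ t) (m : ℕ) (φ : GenPowerSeries)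
    {c d : ℕ → ℂ} (h : ∀ k, φ.exponent k < t → c k = d k) (i : Fin (m + 1)) :
    hahnTuple l hl m (φ.withCoeff c) i - hahnTuple l hl m (φ.withCoeff d) i ∈ hahnFilt t := by
  induction m generalizing φ with
  | zero => simp [hahnTuple]
  | succ m ih =>
    refine Fin.cases ?_ (fun j => ?_) i
    · rw [hahnTuple, hahnTuple, Fin.cons_zero, Fin.cons_zero, toHahn_withCoeff_sub]
      exact toHahn_mem_hahnFilt fun k hk => sub_eq_zero.2 (h k hk)
    · refine ih (φ.mahler l hl) (fun k hk => h k ?_) j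
      linarith [φ.two_mul_exponent_le_mahler hl k, φ.exponent_pos k]

/-- The Mahler operator at least doubles exponents, so a perturbation of `φ` of order `t` moves
every other entry only to order `2t`. This is what makes the entry `φ` dominate the linear part. -/
theorem hahnTuple_sub_succ_mem_hahnFilt {t : ℝ} (ht : 0 ≤ t) (m : ℕ) (φ : GenPowerSeries)
    {c d : ℕ → ℂ} (h : ∀ k, φ.exponent k < t → c k = d k) (i : Fin (m + 1)) :
    hahnTuple l hl (m + 1) (φ.withCoeff c) i.succ - hahnTuple l hl (m + 1) (φ.withCoeff d) i.succ
      ∈ hahnFilt (t + t) := by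
  refine hahnTuple_sub_mem_hahnFilt hl (add_nonneg ht ht) m (φ.mahler l hl) (fun k hk => h k ?_) i
  linarith [φ.two_mul_exponent_le_mahler hl k]

theorem hahnNorm_hahnTuple_sub_le {r : ℝ≥0∞} (hr : r ≤ 1) (m : ℕ)
    (φ : GenPowerSeries) (c d : ℕ → ℂ) (i : Fin (m + 1)) :
    hahnNorm r (hahnTuple l hl m (φ.withCoeff c) i - hahnTuple l hl m (φ.withCoeff d) i) ≤
      (φ.withCoeff (c - d)).absNorm r := by
  induction m generalizing φ with
  | zero => simp [hahnTuple, hahnNorm_zero]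
  | succ m ih =>
    refine Fin.cases ?_ (fun j => ?_) i
    · rw [hahnTuple, hahnTuple, Fin.cons_zero, Fin.cons_zero, toHahn_withCoeff_sub,
        hahnNorm_toHahn]
    · exact (ih (φ.mahler l hl) j).trans (absNorm_mahler_le (φ.withCoeff (c - d)) hl hr)

theorem hahnNorm_hahnTuple_sub_succ_le {r : ℝ≥0∞} (h0 : r ≠ 0) (hr : r ≤ 1) (m : ℕ)
    (φ : GenPowerSeries) {c d : ℕ → ℂ} {t : ℝ} (h : ∀ k, φ.exponent k < t → c k = d k)
    (i : Fin (m + 1)) :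
    hahnNorm r (hahnTuple l hl (m + 1) (φ.withCoeff c) i.succ -
      hahnTuple l hl (m + 1) (φ.withCoeff d) i.succ) ≤
      r ^ t * (φ.withCoeff (c - d)).absNorm r :=
  (hahnNorm_hahnTuple_sub_le hl hr m (φ.mahler l hl) c d i).trans
    (absNorm_mahler_le_rpow_mul (φ := φ.withCoeff (c - d)) hl h0 hr
      fun k hk => sub_eq_zero.2 (h k hk))

end GenPowerSeries

/-! ### Formal zeros and elimination of a variable -/

theorem truncTotal_pderiv {ι : Type*} [Finite ι] (i : ι) (b : MvPowerSeries ι ℂ) (K : ℕ) :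
    (MvPowerSeries.pderiv ℂ i b).truncTotal K = MvPolynomial.pderiv i (b.truncTotal (K + 1)) := by
  ext p
  simp only [MvPolynomial.coeff_pderiv, MvPowerSeries.coeff_truncTotal_eq_ite,
    MvPowerSeries.coeff_pderiv, map_add, Finsupp.degree_single, add_lt_add_iff_right]
  split_ifs <;> simp

theorem truncTotal_iterate_pderiv {ι : Type*} [Finite ι] (i : ι) (b : MvPowerSeries ι ℂ)
    (k K : ℕ) : ((MvPowerSeries.pderiv ℂ i)^[k] b).truncTotal K =
      (MvPolynomial.pderiv i)^[k] (b.truncTotal (K + k)) := by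
  induction k generalizing K with
  | zero => rfl
  | succ k ih =>
    rw [Function.iterate_succ_apply', truncTotal_pderiv, ih, Function.iterate_succ_apply',
      add_right_comm, add_assoc]

/-- `b` vanishes formally at `z`: the truncations of `b` at total degree `K`, evaluated at `z`,
have exponents at least `ε K`. -/
def IsFormalZero {ι : Type*} [Finite ι] (ε : ℝ) (z : ι → HahnSeries ℝ ℂ)
    (b : MvPowerSeries ι ℂ) : Prop :=
  ∀ K : ℕ, MvPolynomial.aeval z (b.truncTotal K) ∈ hahnFilt (ε * K)

section Slice

variable {m : ℕ}

/-- The coefficient of the `k`-th power of the variable with index `0`. -/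
def MvPowerSeries.slice (k : ℕ) (b : MvPowerSeries (Fin (m + 1)) ℂ) : MvPowerSeries (Fin m) ℂ :=
  fun p => MvPowerSeries.coeff (p.cons k) b

theorem MvPowerSeries.coeff_slice (k : ℕ) (b : MvPowerSeries (Fin (m + 1)) ℂ) (p : Fin m →₀ ℕ) :
    MvPowerSeries.coeff p (b.slice k) = MvPowerSeries.coeff (p.cons k) b := rfl

theorem degree_cons (k : ℕ) (p : Fin m →₀ ℕ) : (p.cons k).degree = k + p.degree := by
  simp [Finsupp.degree_eq_sum, Fin.sum_univ_succ]

theorem coeff_finSuccEquiv_truncTotal (b : MvPowerSeries (Fin (m + 1)) ℂ) (k K : ℕ) :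
    (MvPolynomial.finSuccEquiv ℂ m (b.truncTotal (K + k))).coeff k = (b.slice k).truncTotal K := by
  ext p
  rw [MvPolynomial.finSuccEquiv_coeff_coeff, MvPowerSeries.coeff_truncTotal_eq_ite,
    MvPowerSeries.coeff_truncTotal_eq_ite, degree_cons, MvPowerSeries.coeff_slice, add_comm K]
  simp only [add_lt_add_iff_left]

theorem finSuccEquiv_pderiv_zero (g : MvPolynomial (Fin (m + 1)) ℂ) :
    MvPolynomial.finSuccEquiv ℂ m (MvPolynomial.pderiv 0 g) =
      Polynomial.derivative (MvPolynomial.finSuccEquiv ℂ m g) := by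
  ext k p
  have h : p.cons k + Finsupp.single 0 1 = p.cons (k + 1) := by
    ext i
    refine Fin.cases ?_ (fun j => ?_) i <;> simp
  have h' : ((k : MvPolynomial (Fin m) ℂ) + 1) = MvPolynomial.C ((k : ℂ) + 1) := by simp
  rw [MvPolynomial.finSuccEquiv_coeff_coeff, MvPolynomial.coeff_pderiv,
    Polynomial.coeff_derivative, h, h', mul_comm,
    mul_comm (Polynomial.coeff _ _), MvPolynomial.coeff_C_mul,
    MvPolynomial.finSuccEquiv_coeff_coeff, Finsupp.cons_zero]

theorem aeval_eq_eval_finSuccEquiv {R : Type*} [CommRing R] [Algebra ℂ R] (z : Fin (m + 1) → R)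
    (g : MvPolynomial (Fin (m + 1)) ℂ) :
    MvPolynomial.aeval z g = ((MvPolynomial.finSuccEquiv ℂ m g).map
      (MvPolynomial.aeval (Fin.tail z) : MvPolynomial (Fin m) ℂ →ₐ[ℂ] R).toRingHom).eval (z 0) := by
  induction g using MvPolynomial.induction_on with
  | C a => simp [MvPolynomial.finSuccEquiv_apply]
  | add p q hp hq => simp [hp, hq]
  | mul_X p i hp =>
    rw [map_mul, map_mul, Polynomial.map_mul, Polynomial.eval_mul, ← hp, MvPolynomial.aeval_X]
    congr 1
    refine Fin.cases ?_ (fun j => ?_) i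
    · rw [MvPolynomial.finSuccEquiv_X_zero]
      simp
    · rw [MvPolynomial.finSuccEquiv_X_succ]
      simp [Fin.tail]

/-- All Taylor coefficients at `z 0` of `b`, as a series in its first variable, vanish; hence so do
its coefficients at `0`. For truncations this becomes a count of orders, in which powers of `z 0`
make up for lower truncation degrees. -/
theorem isFormalZero_slice {ε : ℝ} (hε : 0 < ε) {z : Fin (m + 1) → HahnSeries ℝ ℂ}
    (hz : ∀ i, z i ∈ hahnFilt ε) {b : MvPowerSeries (Fin (m + 1)) ℂ}
    (hb : ∀ k, IsFormalZero ε z ((MvPowerSeries.pderiv ℂ 0)^[k] b)) (k : ℕ) :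
    IsFormalZero ε (Fin.tail z) (b.slice k) := by
  intro K
  -- Taking the coefficient of the `k`-th power lowers the total degree by `k`, so the truncation
  -- starts at `K + k`.
  set g := b.truncTotal (K + k) with hg
  set q := (MvPolynomial.finSuccEquiv ℂ m g).map
    (MvPolynomial.aeval (Fin.tail z) : MvPolynomial (Fin m) ℂ →ₐ[ℂ] HahnSeries ℝ ℂ).toRingHom
    with hq
  have hz0 : ∀ i, z i ∈ hahnFilt 0 := fun i => hahnFilt_anti hε.le (hz i)
  have hder : ∀ n, (Polynomial.derivative^[n] q).eval (z 0) =
      MvPolynomial.aeval z ((MvPolynomial.pderiv 0)^[n] g) := by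
    intro n
    rw [aeval_eq_eval_finSuccEquiv, hq, Polynomial.iterate_derivative_map]
    congr 2
    clear_value g
    induction n with
    | zero => rfl
    | succ n ih =>
      rw [Function.iterate_succ_apply', Function.iterate_succ_apply', finSuccEquiv_pderiv_zero, ih]
  have hder_mem : ∀ n : ℕ, (Polynomial.derivative^[n] q).eval (z 0) ∈
      hahnFilt (ε * (K + k - n : ℝ)) := by
    intro n
    rw [hder]
    rcases le_total n (K + k) with hn | hn
    · obtain ⟨j, hj⟩ := Nat.exists_eq_add_of_le' hn
      rw [hg, hj, ← truncTotal_iterate_pderiv]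
      have h1 : (K + k - n : ℝ) = j := by
        have : ((K + k : ℕ) : ℝ) = j + n := by rw [hj]; push_cast; ring
        push_cast at this
        linarith
      rw [h1]
      exact hb n j
    -- Once `n ≥ K + k` the claimed order is at most `0` and nonnegativity of exponents suffices.
    · refine hahnFilt_anti ?_ (aeval_mem_hahnFilt hz0 _)
      have : ((K + k : ℕ) : ℝ) ≤ n := by exact_mod_cast hn
      push_cast at this
      nlinarith
  have htaylor : ∀ n : ℕ, (Polynomial.taylor (z 0) q).coeff n ∈ hahnFilt (ε * (K + k - n : ℝ)) := by
    intro n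
    have hfac : ((n.factorial : ℕ) : ℂ) ≠ 0 := by exact_mod_cast n.factorial_ne_zero
    rw [Polynomial.taylor_coeff, ← Submodule.smul_mem_iff _ hfac]
    convert hder_mem n using 1
    rw [← Polynomial.factorial_smul_hasseDeriv]
    simp [Nat.cast_smul_eq_nsmul]
  have hcoeff : q.coeff k = MvPolynomial.aeval (Fin.tail z) ((b.slice k).truncTotal K) := by
    rw [hq, Polynomial.coeff_map, hg, coeff_finSuccEquiv_truncTotal]
    rfl
  rw [← hcoeff]
  -- Expanding back from `z 0` to `0` expresses the `k`-th coefficient through the Taylor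
  -- coefficients with index `j + k`, of order `ε (K - j)`, times `(-z 0) ^ j`, of order `ε j`.
  have hq' : q = Polynomial.taylor (-z 0) (Polynomial.taylor (z 0) q) := by
    rw [Polynomial.taylor_taylor, neg_add_cancel, Polynomial.taylor_zero]
  rw [hq', Polynomial.taylor_coeff, Polynomial.eval_eq_sum_range]
  refine sum_mem fun j _ => ?_
  rw [Polynomial.hasseDeriv_coeff, ← nsmul_eq_mul, smul_mul_assoc]
  refine nsmul_mem ?_ _
  have h1 : ε * (K : ℝ) = ε * (K + k - (j + k : ℕ) : ℝ) + ε * j := by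
    push_cast
    ring
  rw [h1]
  exact mul_mem_hahnFilt (htaylor _) (pow_mem_hahnFilt (neg_mem (hz 0)) j)

end Slice

/-! ### Leading terms -/

theorem coeff_truncTotal_sub_of_le {ι : Type*} [Finite ι] (b : MvPowerSeries ι ℂ) {K L : ℕ}
    (hKL : K ≤ L) (p : ι →₀ ℕ) (hp : p.degree < K) :
    (b.truncTotal L - b.truncTotal K).coeff p = 0 := by
  rw [MvPolynomial.coeff_sub, MvPowerSeries.coeff_truncTotal _ (hp.trans_le hKL),
    MvPowerSeries.coeff_truncTotal _ hp, sub_self]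

/-- If `b` does not vanish formally at `z`, its value at `z` has a leading term. -/
theorem exists_leading_term {ι : Type*} [Fintype ι] {ε : ℝ} (hε : 0 < ε)
    {z : ι → HahnSeries ℝ ℂ} (hz : ∀ i, z i ∈ hahnFilt ε) {b : MvPowerSeries ι ℂ}
    (hb : ¬ IsFormalZero ε z b) :
    ∃ (v : ℝ) (α : ℂ) (δ : ℝ) (K₀ : ℕ), 0 ≤ v ∧ α ≠ 0 ∧ 0 < δ ∧ δ ≤ 1 ∧ ∀ K ≥ K₀,
      MvPolynomial.aeval z (b.truncTotal K) - HahnSeries.single v α ∈ hahnFilt (v + δ) := by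
  have hdiff : ∀ K L : ℕ, K ≤ L → MvPolynomial.aeval z (b.truncTotal L) -
      MvPolynomial.aeval z (b.truncTotal K) ∈ hahnFilt (ε * K) := by
    intro K L hKL
    rw [← map_sub]
    exact aeval_mem_hahnFilt_of_degree hε.le hz _ K (coeff_truncTotal_sub_of_le b hKL)
  simp only [IsFormalZero, mem_hahnFilt, not_forall] at hb
  obtain ⟨K₁, u, hu, hu'⟩ := hb
  set A := MvPolynomial.aeval z (b.truncTotal K₁) with hA
  have hA0 : A ≠ 0 := fun h => hu' (by simp [h])
  have hAF : A ∈ hahnFilt 0 := aeval_mem_hahnFilt (fun i => hahnFilt_anti hε.le (hz i)) _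
  have hv : A.order ≤ u := HahnSeries.order_le_of_coeff_ne_zero hu'
  have hA_lead : A.coeff A.order ≠ 0 := HahnSeries.coeff_order_eq_zero.not.2 hA0
  -- Beyond this degree, further truncation changes only exponents at least `A.order + 1`; this is
  -- also why `δ` is capped at `1`.
  obtain ⟨K₂, hK₂⟩ := exists_nat_gt ((A.order + 1) / ε)
  rw [div_lt_iff₀ hε, mul_comm] at hK₂
  set K₀ := max K₁ K₂
  have hK₀ : A.order + 1 ≤ ε * K₀ := hK₂.le.trans (by gcongr; exact le_max_right _ _)
  set B := MvPolynomial.aeval z (b.truncTotal K₀) - HahnSeries.single A.order (A.coeff A.order)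
    with hB
  have hBcoeff : ∀ w ≤ A.order, B.coeff w = 0 := by
    intro w hw
    have h1 := hdiff K₁ K₀ (le_max_left _ _) w (by linarith)
    rw [HahnSeries.coeff_sub, sub_eq_zero, ← hA] at h1
    rw [hB, HahnSeries.coeff_sub, h1]
    rcases hw.eq_or_lt with rfl | hw
    · simp
    · rw [HahnSeries.coeff_single_of_ne hw.ne, HahnSeries.coeff_eq_zero_of_lt_order hw, sub_zero]
  obtain ⟨δ, hδ0, hδ1, hδ⟩ : ∃ δ : ℝ, 0 < δ ∧ δ ≤ 1 ∧ B ∈ hahnFilt (A.order + δ) := by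
    by_cases hB0 : B = 0
    · exact ⟨1, one_pos, le_rfl, hB0 ▸ zero_mem _⟩
    · have h1 : A.order < B.order := by
        by_contra! h
        exact HahnSeries.coeff_order_eq_zero.not.2 hB0 (hBcoeff _ h)
      refine ⟨min 1 (B.order - A.order), lt_min one_pos (sub_pos.2 h1), min_le_left _ _, ?_⟩
      intro w hw
      refine HahnSeries.coeff_eq_zero_of_lt_order (hw.trans_le ?_)
      linarith [min_le_right 1 (B.order - A.order)]
  refine ⟨A.order, A.coeff A.order, δ, K₀, ?_, hA_lead, hδ0, hδ1, fun K hK => ?_⟩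
  · by_contra! h
    exact hA_lead (hAF _ h)
  · have h1 := hahnFilt_anti (s := A.order + δ) (by linarith) (hdiff K₀ K hK)
    convert add_mem h1 hδ using 1
    rw [hB]
    abel

/-- Below `t` the two series are opposite, and from `t` on `f` has no terms. -/
theorem hahnNorm_le_of_add_mem_hahnFilt {r : ℝ≥0∞} {t : ℝ} {f g : HahnSeries ℝ ℂ}
    (h : f + g ∈ hahnFilt t) (hf : ∀ u, t ≤ u → f.coeff u = 0) : hahnNorm r f ≤ hahnNorm r g := by
  refine ENNReal.tsum_le_tsum fun u => ?_
  rcases lt_or_ge u t with hu | hu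
  · have : f.coeff u = - g.coeff u := by
      rw [eq_neg_iff_add_eq_zero, ← HahnSeries.coeff_add]
      exact h u hu
    simp [this]
  · simp [hf u hu]

theorem hahnNorm_single_mul {r : ℝ≥0∞} (h0 : r ≠ 0) (h1 : r ≠ ⊤) (v : ℝ) (α : ℂ)
    (f : HahnSeries ℝ ℂ) :
    hahnNorm r (HahnSeries.single v α * f) = ‖α‖ₑ * r ^ v * hahnNorm r f := by
  rw [hahnNorm, hahnNorm, ← ENNReal.tsum_mul_left, ← (Equiv.addRight v).tsum_eq]
  refine tsum_congr fun t => ?_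
  rw [Equiv.coe_addRight, HahnSeries.coeff_single_mul, add_sub_cancel_right, enorm_mul,
    ENNReal.rpow_add _ _ h0 h1]
  ring

theorem linearPart_succ {n : ℕ} {R : Type*} [CommRing R] [Algebra ℂ R] (z h : Fin (n + 1) → R)
    (g : MvPolynomial (Fin (n + 1)) ℂ) :
    linearPart z h g = h 0 * MvPolynomial.aeval z (MvPolynomial.pderiv 0 g) +
      ∑ i : Fin n, h i.succ * MvPolynomial.aeval z (MvPolynomial.pderiv i.succ g) :=
  Fin.sum_univ_succ _

/-! ### Truncations of the solution and the recursive estimate -/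

namespace GenPowerSeries

/-- The coefficients of the truncation of `φ` to exponents below `t`. -/
def truncCoeff (φ : GenPowerSeries) (t : ℝ) (k : ℕ) : ℂ :=
  if φ.exponent k < t then φ.coeff k else 0

/-- The tuple `(φ, μφ, …, μ^(m-1) φ, x)` for the truncation of `φ` to exponents below `t`. -/
def truncTuple (φ : GenPowerSeries) (l : ℕ) (hl : 2 ≤ l) (m : ℕ) (t : ℝ) :
    Fin (m + 1) → HahnSeries ℝ ℂ :=
  hahnTuple l hl m (φ.withCoeff (φ.truncCoeff t))

/-- The part of `φ` with exponents in `[s, t)`. -/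
def window (φ : GenPowerSeries) (s t : ℝ) : GenPowerSeries :=
  φ.withCoeff (φ.truncCoeff t - φ.truncCoeff s)

theorem truncCoeff_eq_of_lt {φ : GenPowerSeries} {s t : ℝ} (hst : s ≤ t) (k : ℕ)
    (hk : φ.exponent k < s) : φ.truncCoeff t k = φ.truncCoeff s k := by
  simp [truncCoeff, hk, hk.trans_le hst]

variable {l : ℕ} (hl : 2 ≤ l) (φ : GenPowerSeries) {m : ℕ} {v δ s t : ℝ} {α : ℂ}
  {g : MvPolynomial (Fin (m + 2)) ℂ}

theorem aeval_truncTuple_sub_mem_hahnFilt (ht : 0 ≤ t) (g : MvPolynomial (Fin (m + 1)) ℂ) :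
    MvPolynomial.aeval (hahnTuple l hl m φ) g - MvPolynomial.aeval (φ.truncTuple l hl m t) g ∈
      hahnFilt t := by
  have := aeval_add_sub_mem_hahnFilt (z := φ.truncTuple l hl m t)
    (h := hahnTuple l hl m φ - φ.truncTuple l hl m t) ht
    (fun i => hahnTuple_mem_hahnFilt_zero hl m _ i)
    (fun i => hahnTuple_sub_mem_hahnFilt hl ht m φ (c := φ.coeff)
      (fun k hk => by simp [truncCoeff, hk]) i) g
  simpa using this

theorem aeval_truncTuple_sub_single_mem_hahnFilt (hv : 0 ≤ v + δ) (ht : v + δ ≤ t)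
    {g : MvPolynomial (Fin (m + 1)) ℂ}
    (hg : MvPolynomial.aeval (hahnTuple l hl m φ) g - HahnSeries.single v α ∈
      hahnFilt (v + δ)) :
    MvPolynomial.aeval (φ.truncTuple l hl m t) g - HahnSeries.single v α ∈ hahnFilt (v + δ) := by
  have h := hahnFilt_anti ht (aeval_truncTuple_sub_mem_hahnFilt hl φ (hv.trans ht) g)
  convert sub_mem hg h using 1
  abel

/-- Taylor expansion at the truncated tuple. Replacing the derivative in the slot of `φ` by its
leading term costs order `v + δ + t`; the other linear terms and the remainder have order `2t`,
which is enough because `v + δ ≤ t`. -/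
theorem single_mul_tail_add_mem_hahnFilt (hv : 0 ≤ v) (hδ : 0 ≤ δ) (ht : v + δ ≤ t)
    (hg : MvPolynomial.aeval (hahnTuple l hl (m + 1) φ) g ∈ hahnFilt (v + δ + t))
    (hg' : MvPolynomial.aeval (hahnTuple l hl (m + 1) φ) (MvPolynomial.pderiv 0 g) -
      HahnSeries.single v α ∈ hahnFilt (v + δ)) :
    HahnSeries.single v α * (φ.toHahn - (φ.withCoeff (φ.truncCoeff t)).toHahn) +
      MvPolynomial.aeval (φ.truncTuple l hl (m + 1) t) g ∈ hahnFilt (v + δ + t) := by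
  have ht0 : 0 ≤ t := (add_nonneg hv hδ).trans ht
  set z := φ.truncTuple l hl (m + 1) t
  set h := hahnTuple l hl (m + 1) φ - z with hh
  have hcoeff : ∀ k, φ.exponent k < t → φ.coeff k = φ.truncCoeff t k :=
    fun k hk => by simp [truncCoeff, hk]
  have hz : ∀ i, z i ∈ hahnFilt 0 := fun i => hahnTuple_mem_hahnFilt_zero hl _ _ i
  have hht : ∀ i, h i ∈ hahnFilt t :=
    fun i => hahnTuple_sub_mem_hahnFilt hl ht0 (m + 1) φ hcoeff i
  have hsucc : ∀ i : Fin (m + 1), h i.succ ∈ hahnFilt (t + t) :=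
    fun i => hahnTuple_sub_succ_mem_hahnFilt hl ht0 m φ hcoeff i
  have h0 : φ.toHahn - (φ.withCoeff (φ.truncCoeff t)).toHahn = h 0 := rfl
  have htay := aeval_add_eq z h g
  rw [hh, add_sub_cancel, ← hh, linearPart_succ] at htay
  have e1 := mul_mem_hahnFilt
    (aeval_truncTuple_sub_single_mem_hahnFilt hl φ (add_nonneg hv hδ) ht hg') (hht 0)
  have e2 : ∑ i : Fin (m + 1), h i.succ * MvPolynomial.aeval z (MvPolynomial.pderiv i.succ g) ∈
      hahnFilt (v + δ + t) := sum_mem fun i _ =>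
    hahnFilt_anti (by linarith) (mul_mem_hahnFilt_of_left (hsucc i) (aeval_mem_hahnFilt hz _))
  have e3 := hahnFilt_anti (s := v + δ + t) (by linarith) (taylorRem_mem_hahnFilt ht0 hz hht g)
  rw [h0]
  convert sub_mem (sub_mem (sub_mem hg e1) e2) e3 using 1
  rw [htay]
  ring

theorem toHahn_sub_truncCoeff_mem_hahnFilt :
    φ.toHahn - (φ.withCoeff (φ.truncCoeff t)).toHahn ∈ hahnFilt t := by
  have := φ.toHahn_withCoeff_sub φ.coeff (φ.truncCoeff t)
  change φ.toHahn - _ = _ at this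
  rw [this]
  exact toHahn_mem_hahnFilt fun k hk => sub_eq_zero.2 (by
    have : φ.exponent k < t := hk
    simp [truncCoeff, this])

theorem aeval_truncTuple_mem_hahnFilt (hv : 0 ≤ v) (hδ : 0 ≤ δ) (ht : v + δ ≤ t)
    (hg : MvPolynomial.aeval (hahnTuple l hl (m + 1) φ) g ∈ hahnFilt (v + δ + t))
    (hg' : MvPolynomial.aeval (hahnTuple l hl (m + 1) φ) (MvPolynomial.pderiv 0 g) -
      HahnSeries.single v α ∈ hahnFilt (v + δ)) :
    MvPolynomial.aeval (φ.truncTuple l hl (m + 1) t) g ∈ hahnFilt (v + t) := by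
  have h1 := hahnFilt_anti (s := v + t) (by linarith)
    (single_mul_tail_add_mem_hahnFilt hl φ hv hδ ht hg hg')
  have h2 := mul_mem_hahnFilt (single_mem_hahnFilt v α) (φ.toHahn_sub_truncCoeff_mem_hahnFilt
    (t := t))
  simpa using sub_mem h1 h2

theorem toHahn_window : (φ.window s t).toHahn =
    (φ.withCoeff (φ.truncCoeff t)).toHahn - (φ.withCoeff (φ.truncCoeff s)).toHahn :=
  (φ.toHahn_withCoeff_sub _ _).symm

theorem coeff_toHahn_window_of_le {u : ℝ} (hst : s ≤ t) (hu : t ≤ u) :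
    (φ.window s t).toHahn.coeff u = 0 := by
  by_cases hu' : u ∈ Set.range φ.exponent
  · obtain ⟨k, rfl⟩ := hu'
    refine ((φ.window s t).toHahn_coeff_exponent k).trans ?_
    simp [window, withCoeff, truncCoeff, hu.not_gt, (hst.trans hu).not_gt]
  · exact toHahn_coeff_of_notMem _ hu'

/-- The fundamental estimate: the part of `φ` with exponents in `[s, t + δ)` in terms of the part
with exponents in `[s, t)`. -/
theorem absNorm_window_step {r : ℝ≥0∞} (h0 : r ≠ 0) (h1 : r ≤ 1) (hv : 0 ≤ v) (hδ : 0 ≤ δ)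
    (hst : s ≤ t) (ht : v + δ ≤ t)
    (hg : MvPolynomial.aeval (hahnTuple l hl (m + 1) φ) g ∈ hahnFilt (v + δ + t))
    (hg' : MvPolynomial.aeval (hahnTuple l hl (m + 1) φ) (MvPolynomial.pderiv 0 g) -
      HahnSeries.single v α ∈ hahnFilt (v + δ)) :
    ‖α‖ₑ * r ^ v * (φ.window s (t + δ)).absNorm r ≤
      hahnNorm r (MvPolynomial.aeval (φ.truncTuple l hl (m + 1) s) g) +
      ((φ.window s t).absNorm r *
        hahnNorm r (MvPolynomial.aeval (φ.truncTuple l hl (m + 1) s) (MvPolynomial.pderiv 0 g) -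
          HahnSeries.single v α) +
      ∑ i : Fin (m + 1), r ^ s * (φ.window s t).absNorm r *
        hahnNorm r (MvPolynomial.aeval (φ.truncTuple l hl (m + 1) s)
          (MvPolynomial.pderiv i.succ g))) +
      hahnNorm r (taylorRem (φ.truncTuple l hl (m + 1) s)
        (φ.truncTuple l hl (m + 1) t - φ.truncTuple l hl (m + 1) s) g) := by
  have hr : r ≠ ⊤ := ne_top_of_le_ne_top ENNReal.one_ne_top h1
  set z := φ.truncTuple l hl (m + 1) s with hz
  set w := φ.truncTuple l hl (m + 1) t with hw
  set h := w - z with hh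
  have hh0 : h 0 = (φ.window s t).toHahn := φ.toHahn_withCoeff_sub _ _
  -- Subtract the tail of `φ` beyond `t + δ`, which after multiplication by `α x ^ v` has order `v +
  -- δ + t`, from the relation for the tail beyond `t`.
  have key : HahnSeries.single v α * (φ.window s (t + δ)).toHahn +
      (MvPolynomial.aeval w g - HahnSeries.single v α * h 0) ∈ hahnFilt (v + δ + t) := by
    have e1 := single_mul_tail_add_mem_hahnFilt hl φ hv hδ ht hg hg'
    have e2 := mul_mem_hahnFilt (single_mem_hahnFilt v α) (φ.toHahn_sub_truncCoeff_mem_hahnFilt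
      (t := t + δ))
    rw [show v + (t + δ) = v + δ + t by ring] at e2
    convert sub_mem e1 e2 using 1
    rw [hh0, toHahn_window, toHahn_window]
    ring
  have hle := hahnNorm_le_of_add_mem_hahnFilt (r := r) key (fun u hu => by
    rw [HahnSeries.coeff_single_mul, φ.coeff_toHahn_window_of_le (by linarith) (by linarith),
      mul_zero])
  rw [hahnNorm_single_mul h0 hr, hahnNorm_toHahn] at hle
  refine hle.trans ?_
  -- Expanding at the fixed truncation `s` makes the leading terms cancel, so the window `[s, t)`
  -- enters linearly only with small factors.
  have hexp : MvPolynomial.aeval w g - HahnSeries.single v α * h 0 =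
      MvPolynomial.aeval z g + (h 0 * (MvPolynomial.aeval z (MvPolynomial.pderiv 0 g) -
        HahnSeries.single v α) + ∑ i : Fin (m + 1), h i.succ *
          MvPolynomial.aeval z (MvPolynomial.pderiv i.succ g)) + taylorRem z h g := by
    have htay := aeval_add_eq z h g
    rw [hh, add_sub_cancel, ← hh, linearPart_succ] at htay
    rw [htay]
    ring
  rw [hexp]
  refine (hahnNorm_add_le _ _ _).trans (add_le_add_left ((hahnNorm_add_le _ _ _).trans
    (add_le_add_right ((hahnNorm_add_le _ _ _).trans (add_le_add ?_ ?_)) _)) _)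
  · refine (hahnNorm_mul_le h0 hr _ _).trans ?_
    rw [hh0, hahnNorm_toHahn]
  · refine (hahnNorm_sum_le _ _ _).trans (Finset.sum_le_sum fun i _ => ?_)
    refine (hahnNorm_mul_le h0 hr _ _).trans (mul_le_mul_left ?_ _)
    exact hahnNorm_hahnTuple_sub_succ_le hl h0 h1 m φ (fun k hk => truncCoeff_eq_of_lt hst k hk) i

end GenPowerSeries

/-! ### Convergence in the regular case -/

theorem exists_small_mul_rpow_le {C X Y : ℝ≥0∞} (hC : C ≠ ⊤) (hX : X ≠ 0) (hY : Y ≠ 0) {δ : ℝ}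
    (hδ : 0 < δ) : ∃ σ : ℝ≥0∞, σ ≠ 0 ∧ σ ≤ 1 ∧ σ ≤ Y ∧ C * σ ^ δ ≤ X := by
  have hXC : X / C ≠ 0 := by simp [ENNReal.div_eq_zero_iff, hX, hC]
  have hpow : (X / C) ^ δ⁻¹ ≠ 0 := by
    simp [ENNReal.rpow_eq_zero_iff, hXC, hδ.le]
  refine ⟨min (min 1 Y) ((X / C) ^ δ⁻¹), ?_, (min_le_left _ _).trans (min_le_left _ _),
    (min_le_left _ _).trans (min_le_right _ _), ?_⟩
  · rcases min_choice (min 1 Y) ((X / C) ^ δ⁻¹) with h | h <;> rw [h]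
    · rcases min_choice 1 Y with h | h <;> rw [h]
      exacts [one_ne_zero, hY]
    · exact hpow
  · calc _ ≤ C * ((X / C) ^ δ⁻¹) ^ δ := by
          gcongr
          exact min_le_right _ _
      _ = C * (X / C) := by rw [ENNReal.rpow_inv_rpow hδ.ne']
      _ ≤ X := ENNReal.mul_div_le

theorem absSum_mono {ι : Type*} (b : MvPowerSeries ι ℂ) {ρ ρ' : ℝ≥0∞} (h : ρ ≤ ρ') :
    absSum b ρ ≤ absSum b ρ' :=
  ENNReal.tsum_le_tsum fun p => by gcongr

namespace GenPowerSeries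

theorem absNorm_mono (φ : GenPowerSeries) {r r' : ℝ≥0∞} (h : r ≤ r') :
    φ.absNorm r ≤ φ.absNorm r' :=
  ENNReal.tsum_le_tsum fun k =>
    mul_le_mul_right (ENNReal.rpow_le_rpow h (φ.exponent_pos k).le) _

theorem absNorm_le_rpow_mul (φ : GenPowerSeries) {r : ℝ≥0∞} (h : r ≤ 1) :
    φ.absNorm r ≤ φ.absNorm 1 * r ^ φ.exponent 0 := by
  rw [absNorm, absNorm, ← ENNReal.tsum_mul_right]
  refine ENNReal.tsum_le_tsum fun k => ?_
  rw [ENNReal.one_rpow, mul_one]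
  refine mul_le_mul_right (ENNReal.rpow_le_rpow_of_exponent_ge h ?_) _
  exact φ.strictMono_exponent.monotone (Nat.zero_le k)

theorem absNorm_withCoeff_add_le (φ : GenPowerSeries) (c d : ℕ → ℂ) (r : ℝ≥0∞) :
    (φ.withCoeff (c + d)).absNorm r ≤ (φ.withCoeff c).absNorm r + (φ.withCoeff d).absNorm r := by
  rw [absNorm, absNorm, absNorm, ← ENNReal.tsum_add]
  refine ENNReal.tsum_le_tsum fun k => ?_
  change ‖c k + d k‖ₑ * r ^ φ.exponent k ≤ ‖c k‖ₑ * r ^ φ.exponent k + ‖d k‖ₑ * r ^ φ.exponent k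
  rw [← add_mul]
  gcongr
  exact enorm_add_le _ _

theorem absNorm_truncCoeff_ne_top (φ : GenPowerSeries) (s : ℝ) {r : ℝ≥0∞} (hr : r ≤ 1) :
    (φ.withCoeff (φ.truncCoeff s)).absNorm r ≠ ⊤ := by
  obtain ⟨N, hN⟩ := (φ.tendsto_exponent.eventually_ge_atTop s).exists
  rw [absNorm, tsum_eq_sum (s := Finset.range N)]
  · refine ENNReal.sum_ne_top.2 fun k _ => ENNReal.mul_ne_top enorm_ne_top ?_
    exact ne_top_of_le_ne_top ENNReal.one_ne_top
      ((ENNReal.rpow_le_rpow hr (φ.exponent_pos k).le).trans (ENNReal.one_rpow _).le)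
  · intro k hk
    have : s ≤ φ.exponent k :=
      hN.trans (φ.strictMono_exponent.monotone (not_lt.1 (Finset.mem_range.not.1 hk)))
    simp [withCoeff, truncCoeff, this.not_gt]

theorem absNorm_ne_top_of_window_le (φ : GenPowerSeries) {s δ : ℝ} (hδ : 0 < δ)
    {r B : ℝ≥0∞} (hr : r ≤ 1) (hB : B ≠ ⊤)
    (h : ∀ j : ℕ, (φ.window s (s + j * δ)).absNorm r ≤ B) : φ.absNorm r ≠ ⊤ := by
  have hle : (φ.withCoeff (φ.coeff - φ.truncCoeff s)).absNorm r ≤ B := by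
    -- Every finite partial sum is contained in some window, so the uniform bound passes to the
    -- whole tail.
    refine ENNReal.tsum_le_of_sum_range_le fun N => ?_
    obtain ⟨j, hj⟩ := exists_nat_gt ((φ.exponent N - s) / δ)
    rw [div_lt_iff₀ hδ] at hj
    refine le_trans (Finset.sum_le_sum fun k hk => ?_)
      ((ENNReal.sum_le_tsum (Finset.range N)).trans (h j))
    have hk' : φ.exponent k < s + j * δ := by
      linarith [φ.strictMono_exponent (Finset.mem_range.1 hk)]
    simp [window, withCoeff, truncCoeff, hk']
  have hadd := φ.absNorm_withCoeff_add_le (φ.truncCoeff s) (φ.coeff - φ.truncCoeff s) r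
  rw [add_sub_cancel] at hadd
  exact ne_top_of_le_ne_top (ENNReal.add_ne_top.2 ⟨φ.absNorm_truncCoeff_ne_top s hr,
    ne_top_of_le_ne_top hB hle⟩) hadd

/-- Convergence in the regular case: the series solves `b = 0`, and the derivative of `b` with
respect to the variable that stands for `φ` itself does not vanish formally. -/
theorem exists_absNorm_ne_top_of_regular {l : ℕ} (hl : 2 ≤ l) (φ : GenPowerSeries) {m : ℕ}
    {ε : ℝ} (hε : 0 < ε) (hε1 : ε ≤ 1) (hεφ : ε ≤ φ.exponent 0)
    {b : MvPowerSeries (Fin (m + 2)) ℂ} {ρ : ℝ≥0∞} (hρ : ρ ≠ 0) (hρt : ρ ≠ ⊤)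
    (hbρ : absSum b (4 * ρ) ≠ ⊤) (hb : IsFormalZero ε (hahnTuple l hl (m + 1) φ) b)
    (hb' : ¬ IsFormalZero ε (hahnTuple l hl (m + 1) φ) (MvPowerSeries.pderiv ℂ 0 b)) :
    ∃ r : ℝ≥0∞, r ≠ 0 ∧ r ≤ 1 ∧ φ.absNorm r ≠ ⊤ := by
  obtain ⟨v, α, δ, K₀, hv, hα, hδ, hδ1, hlead⟩ :=
    exists_leading_term hε (hahnTuple_mem_hahnFilt hl hε1 (m + 1) φ hεφ) hb'
  -- Then `b` at the truncation has order at least `v + s = 2v + 2`, which is at least `(v + δ) + (v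
  -- + 1)`, the exponent of `y * x` below.
  set s := v + 2 with hs
  set S := absSum b (4 * ρ) with hS
  set z := φ.truncTuple l hl (m + 1) s with hz
  have hpoly : ∀ t : ℝ, ∃ K : ℕ,
      MvPolynomial.aeval (hahnTuple l hl (m + 1) φ) (b.truncTotal K) ∈ hahnFilt (v + δ + t) ∧
      MvPolynomial.aeval (hahnTuple l hl (m + 1) φ) (MvPolynomial.pderiv 0 (b.truncTotal K)) -
        HahnSeries.single v α ∈ hahnFilt (v + δ) := by
    intro t
    obtain ⟨K, hK⟩ := exists_nat_gt ((v + δ + t) / ε)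
    rw [div_lt_iff₀ hε, mul_comm] at hK
    -- The extra `1` is there because differentiating a truncation lowers its degree by one.
    refine ⟨max K K₀ + 1, hahnFilt_anti ?_ (hb _), ?_⟩
    · refine hK.le.trans (mul_le_mul_of_nonneg_left ?_ hε.le)
      exact_mod_cast (le_max_left K K₀).trans (Nat.le_succ _)
    · rw [← truncTotal_pderiv]
      exact hlead _ (le_max_right _ _)
  have hρ2 : ρ / 2 ≠ 0 := by simp [ENNReal.div_eq_zero_iff, hρ]
  -- The truncation is a finite sum without constant term, so at a small radius it takes up only
  -- half of `ρ`; the other half is left for the windows.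
  obtain ⟨r₀, hr₀, hr₀1, hr₀ρ, hr₀'⟩ := exists_small_mul_rpow_le
    (φ.absNorm_truncCoeff_ne_top s le_rfl) hρ2 hρ φ.exponent_zero_pos
  have hPs : (φ.withCoeff (φ.truncCoeff s)).absNorm r₀ ≤ ρ / 2 :=
    (absNorm_le_rpow_mul _ hr₀1).trans hr₀'
  have hr₀t : r₀ ≠ ⊤ := ne_top_of_le_ne_top ENNReal.one_ne_top hr₀1
  have hhalf : ρ / 2 ≤ ρ := ENNReal.half_le_self
  have hα0 : ‖α‖ₑ ≠ 0 := by simpa using hα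
  -- `W` collects the constants of all terms of the recursive estimate, so that a single condition
  -- `W * σ ^ δ ≤ ‖α‖ₑ * r₀ ^ v` closes the induction.
  set W := S + (S / ρ + ‖α‖ₑ + (m + 1) * (S / ρ)) + S * (ρ⁻¹) ^ 2 with hW
  have hSρ : S / ρ ≠ ⊤ := ENNReal.div_ne_top hbρ hρ
  have hWt : W ≠ ⊤ := by
    have h1 : ((m : ℝ≥0∞) + 1) ≠ ⊤ := by exact_mod_cast ENNReal.natCast_ne_top (m + 1)
    have h2 : (ρ⁻¹) ^ 2 ≠ ⊤ := ENNReal.pow_ne_top (ENNReal.inv_ne_top.2 hρ)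
    exact ENNReal.add_ne_top.2 ⟨ENNReal.add_ne_top.2 ⟨hbρ, ENNReal.add_ne_top.2
      ⟨ENNReal.add_ne_top.2 ⟨hSρ, enorm_ne_top⟩, ENNReal.mul_ne_top h1 hSρ⟩⟩,
      ENNReal.mul_ne_top hbρ h2⟩
  have hX : ‖α‖ₑ * r₀ ^ v ≠ 0 := mul_ne_zero hα0 (by simp [ENNReal.rpow_eq_zero_iff, hr₀, hr₀t])
  obtain ⟨σ, hσ0, hσ1, hσρ, hσ⟩ := exists_small_mul_rpow_le hWt hX hρ2 hδ
  have hσt : σ ≠ ⊤ := ne_top_of_le_ne_top ENNReal.one_ne_top hσ1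
  set r := σ * r₀ with hr
  have hr0 : r ≠ 0 := mul_ne_zero hσ0 hr₀
  have hrr₀ : r ≤ r₀ := mul_le_of_le_one_left zero_le hσ1
  have hrσ : r ≤ σ := mul_le_of_le_one_right zero_le hr₀1
  have hr1 : r ≤ 1 := hrr₀.trans hr₀1
  have hrt : r ≠ ⊤ := ne_top_of_le_ne_top ENNReal.one_ne_top hr1
  -- `x` is the bound propagated along the windows, and `y` is the gain available in each error
  -- term. Dividing `y * x` by the size `σ ^ v` of the leading term leaves `σ ^ δ * x`.
  set x := σ ^ (v + 1) with hx
  set y := σ ^ (v + δ) with hy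
  have hxρ : x ≤ ρ / 2 := by
    refine le_trans ?_ hσρ
    conv_rhs => rw [← ENNReal.rpow_one σ]
    exact ENNReal.rpow_le_rpow_of_exponent_ge hσ1 (by linarith)
  have hxy : x ≤ y := ENNReal.rpow_le_rpow_of_exponent_ge hσ1 (by linarith)
  have hz₀ : ∀ i, hahnNorm r₀ (z i) ≤ ρ :=
    fun i => hahnNorm_hahnTuple_le hl hr₀1 hr₀ρ (m + 1) _ (hPs.trans hhalf) i
  have hzr : ∀ i, hahnNorm r (z i) ≤ ρ := fun i =>
    hahnNorm_hahnTuple_le hl hr1 (hrr₀.trans hr₀ρ) (m + 1) _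
      (((absNorm_mono _ hrr₀).trans hPs).trans hhalf) i
  refine ⟨r, hr0, hr1, φ.absNorm_ne_top_of_window_le (s := s) hδ hr1
    (B := x) (ne_top_of_le_ne_top hρt (hxρ.trans hhalf)) fun j => ?_⟩
  induction j with
  | zero =>
    have : φ.window s (s + (0 : ℕ) * δ) = φ.withCoeff 0 := by simp [window]
    rw [this]
    simp [absNorm, withCoeff]
  | succ j ih =>
    have hst : s ≤ s + j * δ := by
      have : 0 ≤ (j : ℝ) * δ := by positivity
      linarith
    rw [show s + ((j + 1 : ℕ) : ℝ) * δ = s + j * δ + δ by push_cast; ring]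
    generalize s + (j : ℝ) * δ = t at ih hst
    set M := (φ.window s t).absNorm r with hM
    obtain ⟨K, hK, hK'⟩ := hpoly t
    set g := b.truncTotal K with hg
    have ht : v + δ ≤ t := by linarith
    have hstep := φ.absNorm_window_step hl hr0 hr1 hv hδ.le hst ht hK hK'
    have hb1 : hahnNorm r (MvPolynomial.aeval z g) ≤ y * x * S := by
      have h1 := φ.aeval_truncTuple_mem_hahnFilt hl (t := s) hv hδ.le (by linarith)
        (hahnFilt_anti (by linarith) hK) hK'
      refine (hahnNorm_le_rpow_mul hσ1 (by linarith) h1).trans (mul_le_mul' ?_ ?_)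
      · rw [hx, hy, ← ENNReal.rpow_add _ _ hσ0 hσt]
        exact ENNReal.rpow_le_rpow_of_exponent_ge hσ1 (by linarith)
      · refine (hahnNorm_aeval_truncTotal_le hr₀ hr₀t hz₀ b K).trans (absSum_mono b ?_)
        exact le_mul_of_one_le_left zero_le (by norm_num)
    have hder : ∀ r' : ℝ≥0∞, r' ≠ 0 → r' ≠ ⊤ → (∀ i, hahnNorm r' (z i) ≤ ρ) → ∀ i,
        hahnNorm r' (MvPolynomial.aeval z (MvPolynomial.pderiv i g)) ≤ S / ρ := by
      intro r' h0 h1 h2 i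
      rw [ENNReal.le_div_iff_mul_le (Or.inl hρ) (Or.inl hρt)]
      refine (hahnNorm_aeval_pderiv_truncTotal_le h0 h1 h2 i b K).trans (absSum_mono b ?_)
      gcongr
      norm_num
    have hb2 : hahnNorm r (MvPolynomial.aeval z (MvPolynomial.pderiv 0 g) -
        HahnSeries.single v α) ≤ y * (S / ρ + ‖α‖ₑ) := by
      have h1 := φ.aeval_truncTuple_sub_single_mem_hahnFilt hl (t := s) (by linarith)
        (by linarith) hK'
      refine (hahnNorm_le_rpow_mul hσ1 (by linarith) h1).trans (mul_le_mul_right ?_ _)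
      refine (hahnNorm_sub_le _ _ _).trans (add_le_add (hder r₀ hr₀ hr₀t hz₀ 0) ?_)
      rw [hahnNorm_single]
      refine mul_le_of_le_one_right zero_le ?_
      exact (ENNReal.rpow_le_rpow hr₀1 hv).trans (ENNReal.one_rpow _).le
    have hb3 : r ^ s ≤ y := (ENNReal.rpow_le_rpow hrσ (by linarith)).trans
      (ENNReal.rpow_le_rpow_of_exponent_ge hσ1 (by linarith))
    have hb4 : hahnNorm r (taylorRem z (φ.truncTuple l hl (m + 1) t - z) g) ≤
        S * (M * ρ⁻¹) ^ 2 := by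
      refine hahnNorm_taylorRem_truncTotal_le hr0 hrt hzr (fun i => ?_) (fun i => ?_) b K
      · rw [Pi.sub_apply, add_sub_cancel]
        refine hahnNorm_hahnTuple_le hl hr1 (hrr₀.trans hr₀ρ) (m + 1) _ ?_ i
        have hadd := φ.absNorm_withCoeff_add_le (φ.truncCoeff s)
          (φ.truncCoeff t - φ.truncCoeff s) r
        rw [add_sub_cancel] at hadd
        refine hadd.trans ?_
        rw [← ENNReal.add_halves ρ]
        exact add_le_add ((absNorm_mono _ hrr₀).trans hPs) (ih.trans hxρ)
      · rw [mul_comm M, ← mul_assoc, ENNReal.mul_inv_cancel hρ hρt, one_mul]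
        exact hahnNorm_hahnTuple_sub_le hl hr1 (m + 1) φ _ _ i
    have hfinal : ‖α‖ₑ * r ^ v * (φ.window s (t + δ)).absNorm r ≤ ‖α‖ₑ * r ^ v * x := by
      calc _ ≤ _ := hstep
        _ ≤ y * x * S + (x * (y * (S / ρ + ‖α‖ₑ)) + ∑ i : Fin (m + 1), y * x * (S / ρ)) +
            S * ((x * y) * (ρ⁻¹) ^ 2) := by
          refine add_le_add (add_le_add hb1 (add_le_add (mul_le_mul' ih hb2)
            (Finset.sum_le_sum fun i _ => mul_le_mul' (mul_le_mul' hb3 ih)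
              -- The remainder is quadratic in the window: one factor is bounded by `x`, the other
              -- by `y ≥ x`.
              (hder r hr0 hrt hzr i.succ)))) (hb4.trans ?_)
          rw [mul_pow, sq M]
          exact mul_le_mul_right (mul_le_mul_left (mul_le_mul' ih (ih.trans hxy)) _) _
        _ = W * σ ^ δ * (σ ^ v * x) := by
          rw [Finset.sum_const, Finset.card_univ, Fintype.card_fin, nsmul_eq_mul, hW, hy,
            ENNReal.rpow_add _ _ hσ0 hσt]
          push_cast
          ring
        _ ≤ ‖α‖ₑ * r₀ ^ v * (σ ^ v * x) := by gcongr
        _ = _ := by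
          rw [hr, ENNReal.mul_rpow_of_nonneg _ _ hv]
          ring
    have hc0 : ‖α‖ₑ * r ^ v ≠ 0 :=
      mul_ne_zero hα0 (by simp [ENNReal.rpow_eq_zero_iff, hr0, hrt])
    have hct : ‖α‖ₑ * r ^ v ≠ ⊤ :=
      ENNReal.mul_ne_top enorm_ne_top (ENNReal.rpow_ne_top_of_nonneg hv hrt)
    exact (ENNReal.mul_le_mul_iff_right hc0 hct).1 hfinal

end GenPowerSeries

/-! ### Reduction to the regular case -/

theorem absSum_slice_ne_top {m : ℕ} {b : MvPowerSeries (Fin (m + 1)) ℂ} {ρ : ℝ≥0∞} (hρ : ρ ≠ 0)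
    (hb : absSum b ρ ≠ ⊤) (k : ℕ) : absSum (b.slice k) ρ ≠ ⊤ := by
  have key : absSum (b.slice k) ρ * ρ ^ k ≤ absSum b ρ := by
    rw [absSum, ← ENNReal.tsum_mul_right]
    refine le_trans (ENNReal.tsum_le_tsum fun p => ?_)
      (ENNReal.tsum_comp_le_tsum_of_injective (Finsupp.cons_right_injective (n := m) k) _)
    rw [degree_cons, mul_assoc, ← pow_add, add_comm k, MvPowerSeries.coeff_slice]
  intro htop
  rw [htop, ENNReal.top_mul (pow_ne_zero _ hρ), top_le_iff] at key
  exact hb key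

theorem exists_absSum_iterate_pderiv_ne_top {ι : Type*} {b : MvPowerSeries ι ℂ} {ρ : ℝ≥0∞}
    (hρ : ρ ≠ 0) (hρt : ρ ≠ ⊤) (hb : absSum b ρ ≠ ⊤) (i : ι) (k : ℕ) :
    ∃ ρ' : ℝ≥0∞, ρ' ≠ 0 ∧ ρ' ≠ ⊤ ∧ absSum ((MvPowerSeries.pderiv ℂ i)^[k] b) ρ' ≠ ⊤ := by
  induction k with
  | zero => exact ⟨ρ, hρ, hρt, hb⟩
  | succ k ih =>
    obtain ⟨ρ', h0, h1, h2⟩ := ih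
    refine ⟨ρ' / 2, by simp [ENNReal.div_eq_zero_iff, h0], ENNReal.div_ne_top h1 two_ne_zero, ?_⟩
    rw [Function.iterate_succ_apply']
    refine absSum_pderiv_ne_top (by simp [ENNReal.div_eq_zero_iff, h0]) ?_ i
    rwa [ENNReal.mul_div_cancel two_ne_zero ENNReal.ofNat_ne_top]

/-- Substituting `x` for the only variable keeps distinct monomials apart, so a nonzero coefficient
of `b` survives in every sufficiently long truncation. -/
theorem not_isFormalZero_single {ε : ℝ} (hε : 0 < ε) (hε1 : ε ≤ 1) {b : MvPowerSeries (Fin 1) ℂ}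
    (hb : b ≠ 0) : ¬ IsFormalZero ε (fun _ => HahnSeries.single (1 : ℝ) (1 : ℂ)) b := by
  intro h
  obtain ⟨p, hp⟩ : ∃ p, MvPowerSeries.coeff p b ≠ 0 := by
    by_contra! h0
    exact hb (MvPowerSeries.ext h0)
  obtain ⟨K, hK⟩ := exists_nat_gt ((p 0 : ℝ) / ε)
  rw [div_lt_iff₀ hε, mul_comm] at hK
  have hpK : p 0 < K := by
    have : ε * K ≤ K := mul_le_of_le_one_left (Nat.cast_nonneg K) hε1
    exact_mod_cast hK.trans_le this
  have hdeg : p.degree < K := by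
    simpa [Finsupp.degree_eq_sum] using hpK
  have hmem : p ∈ (b.truncTotal K).support := by
    rw [MvPolynomial.mem_support_iff, MvPowerSeries.coeff_truncTotal _ hdeg]
    exact hp
  have h1 := h K (p 0) hK
  rw [MvPolynomial.aeval_def, MvPolynomial.eval₂_eq', HahnSeries.coeff_sum,
    Finset.sum_eq_single_of_mem p hmem] at h1
  · rw [← Algebra.smul_def, MvPowerSeries.coeff_truncTotal _ hdeg] at h1
    simp [HahnSeries.single_pow] at h1
    exact hp h1
  · intro q _ hq
    have hq0 : (p 0 : ℝ) ≠ q 0 := by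
      intro h
      refine hq (Finsupp.ext fun i => ?_)
      rw [Subsingleton.elim i 0]
      exact_mod_cast h.symm
    rw [← Algebra.smul_def]
    simp [HahnSeries.single_pow, HahnSeries.coeff_single_of_ne hq0]

namespace GenPowerSeries

theorem absNorm_mahler (φ : GenPowerSeries) {l : ℕ} (hl : 2 ≤ l) (r : ℝ≥0∞) :
    (φ.mahler l hl).absNorm r = φ.absNorm (r ^ l) := by
  refine tsum_congr fun k => ?_
  rw [mahler, ENNReal.rpow_mul, ENNReal.rpow_natCast]

/-- A generalized power series with a nontrivial convergent relation between its Mahler iterates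
and `x` converges absolutely for small `x`. -/
theorem exists_absNorm_ne_top {l : ℕ} (hl : 2 ≤ l) {ε : ℝ} (hε : 0 < ε) (hε1 : ε ≤ 1) {m : ℕ}
    (φ : GenPowerSeries) (hεφ : ε ≤ φ.exponent 0) {b : MvPowerSeries (Fin (m + 1)) ℂ} (hb0 : b ≠ 0)
    {ρ : ℝ≥0∞} (hρ : ρ ≠ 0) (hρt : ρ ≠ ⊤) (hbρ : absSum b ρ ≠ ⊤)
    (hb : IsFormalZero ε (hahnTuple l hl m φ) b) :
    ∃ r : ℝ≥0∞, r ≠ 0 ∧ r ≤ 1 ∧ φ.absNorm r ≠ ⊤ := by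
  induction m generalizing φ with
  | zero => exact absurd hb (not_isFormalZero_single hε hε1 hb0)
  | succ m ih =>
    -- Either the relation does not involve `φ` formally and a coefficient gives one for `μφ`, or
    -- some derivative is a regular relation for `φ`.
    by_cases h : ∀ k, IsFormalZero ε (hahnTuple l hl (m + 1) φ) ((MvPowerSeries.pderiv ℂ 0)^[k] b)
    · have hslice := isFormalZero_slice hε (hahnTuple_mem_hahnFilt hl hε1 (m + 1) φ hεφ) h
      obtain ⟨k, hk⟩ : ∃ k, b.slice k ≠ 0 := by
        by_contra! h0
        refine hb0 (MvPowerSeries.ext fun p => ?_)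
        rw [← Finsupp.cons_tail p, ← MvPowerSeries.coeff_slice, h0]
        rfl
      have hεφ' : ε ≤ (φ.mahler l hl).exponent 0 := by
        linarith [φ.two_mul_exponent_le_mahler hl 0, φ.exponent_pos 0]
      obtain ⟨r, hr0, hr1, hr⟩ := ih (φ.mahler l hl) hεφ' hk (absSum_slice_ne_top hρ hbρ k)
        (hslice k)
      rw [absNorm_mahler] at hr
      exact ⟨r ^ l, pow_ne_zero _ hr0, pow_le_one₀ zero_le hr1, hr⟩
    · classical
      push Not at h
      have hfind := Nat.find_spec h
      have hmin := fun k => Nat.find_min h (m := k)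
      rcases hk : Nat.find h with _ | k
      · rw [hk] at hfind
        exact absurd hb hfind
      · rw [hk, Function.iterate_succ_apply'] at hfind
        have hzero := not_not.1 (hmin k (by omega))
        obtain ⟨ρ', h0, h1, h2⟩ := exists_absSum_iterate_pderiv_ne_top hρ hρt hbρ 0 k
        -- The regular case asks for absolute convergence of the relation at four times the radius
        -- used there.
        refine exists_absNorm_ne_top_of_regular hl φ hε hε1 hεφ (ρ := ρ' / 4) ?_
          (ENNReal.div_ne_top h1 (by norm_num)) ?_ hzero hfind
        · simp [ENNReal.div_eq_zero_iff, h0]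
        · rwa [ENNReal.mul_div_cancel (by norm_num) ENNReal.ofNat_ne_top]

theorem hahnTuple_apply {l : ℕ} (hl : 2 ≤ l) (m : ℕ) (φ : GenPowerSeries) (i : Fin (m + 1)) :
    hahnTuple l hl m φ i = if (i : ℕ) < m then ((mahler l hl)^[i] φ).toHahn
      else HahnSeries.single 1 1 := by
  induction m generalizing φ with
  | zero => simp [hahnTuple]
  | succ m ih =>
    refine Fin.cases ?_ (fun j => ?_) i
    · simp [hahnTuple]
    · rw [hahnTuple, Fin.cons_succ, ih]
      simp

theorem mahlerTuple_comp_finRotate {l : ℕ} (hl : 2 ≤ l) (n : ℕ) (φ : GenPowerSeries) :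
    φ.mahlerTuple n l hl ∘ finRotate (n + 2) = hahnTuple l hl (n + 1) φ := by
  ext1 i
  rw [hahnTuple_apply, Function.comp_apply]
  split_ifs with h
  · rw [finRotate_of_lt h]
    rfl
  · have hi : i = Fin.last (n + 1) := Fin.ext (by simp; omega)
    rw [hi, finRotate_last]
    rfl

end GenPowerSeries

/-! ### Moving the variable `x` to the last position -/

/-- Permutation of the variables of a power series. -/
def MvPowerSeries.permute {ι : Type*} (e : Equiv.Perm ι) (a : MvPowerSeries ι ℂ) :
    MvPowerSeries ι ℂ :=
  fun p => MvPowerSeries.coeff (p.equivMapDomain e) a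

section Permute

variable {ι : Type*} (e : Equiv.Perm ι) (a : MvPowerSeries ι ℂ)

theorem MvPowerSeries.coeff_permute (p : ι →₀ ℕ) :
    MvPowerSeries.coeff p (a.permute e) = MvPowerSeries.coeff (p.equivMapDomain e) a := rfl

theorem degree_equivMapDomain (p : ι →₀ ℕ) : (p.equivMapDomain e).degree = p.degree := by
  rw [Finsupp.equivMapDomain_eq_mapDomain, Finsupp.degree_mapDomain]

theorem absSum_permute (ρ : ℝ≥0∞) : absSum (a.permute e) ρ = absSum a ρ := by
  refine (tsum_congr fun p => ?_).trans ((Finsupp.equivCongrLeft e).tsum_eq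
    fun p => ‖MvPowerSeries.coeff p a‖ₑ * ρ ^ p.degree)
  rw [Finsupp.equivCongrLeft_apply, degree_equivMapDomain, MvPowerSeries.coeff_permute]

theorem MvPowerSeries.permute_ne_zero {a : MvPowerSeries ι ℂ} (ha : a ≠ 0) : a.permute e ≠ 0 := by
  intro h
  refine ha (MvPowerSeries.ext fun p => ?_)
  obtain ⟨q, rfl⟩ := (Finsupp.equivCongrLeft (M := ℕ) e).surjective p
  rw [Finsupp.equivCongrLeft_apply, ← MvPowerSeries.coeff_permute, h]
  rfl

theorem truncTotal_permute [Finite ι] (K : ℕ) :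
    MvPolynomial.rename e ((a.permute e).truncTotal K) = a.truncTotal K := by
  ext p
  obtain ⟨q, rfl⟩ := (Finsupp.equivCongrLeft (M := ℕ) e).surjective p
  rw [Finsupp.equivCongrLeft_apply]
  conv_lhs => rw [Finsupp.equivMapDomain_eq_mapDomain,
    MvPolynomial.coeff_rename_mapDomain _ e.injective]
  simp only [MvPowerSeries.coeff_truncTotal_eq_ite, degree_equivMapDomain,
    MvPowerSeries.coeff_permute]

theorem isFormalZero_permute [Finite ι] {ε : ℝ} {z : ι → HahnSeries ℝ ℂ}
    {a : MvPowerSeries ι ℂ} (h : IsFormalZero ε z a) :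
    IsFormalZero ε (z ∘ e) (a.permute e) := by
  intro K
  rw [← MvPolynomial.aeval_rename, truncTotal_permute]
  exact h K

end Permute

/-! ### From the given equation to a convergent formal relation -/

/-- A monomial of degree at least `K` contributes only to exponents at least `ε K`; below that the
truncation has the same coefficients as the full substitution. -/
theorem isFormalZero_of_substCoeff_eq_zero {m : ℕ} {a : MvPowerSeries (Fin m) ℂ}
    {Φ : Fin m → HahnSeries ℝ ℂ} {ε : ℝ} (hε : 0 < ε) (hΦ : ∀ i, Φ i ∈ hahnFilt ε)
    (h : ∀ t, substCoeff a Φ t = 0) : IsFormalZero ε Φ a := by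
  intro K u hu
  rw [← h u, substCoeff, MvPolynomial.aeval_def, MvPolynomial.eval₂_eq', HahnSeries.coeff_sum,
    finsum_eq_sum_of_support_subset (s := (a.truncTotal K).support)]
  · refine Finset.sum_congr rfl fun p hp => ?_
    have hdeg : p.degree < K := by
      by_contra! hK
      exact MvPolynomial.mem_support_iff.1 hp (MvPowerSeries.coeff_truncTotal_eq_zero _ hK)
    rw [← Algebra.smul_def, MvPowerSeries.coeff_truncTotal _ hdeg, HahnSeries.coeff_smul,
      smul_eq_mul]
  · intro p hp
    rw [Function.mem_support] at hp
    have hcoeff := left_ne_zero_of_mul hp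
    have hprod := right_ne_zero_of_mul hp
    have hle := le_of_mem_support_prod_pow Finset.univ Φ ε
      (fun i => mem_hahnFilt_iff_support.1 (hΦ i)) p u hprod
    have hdeg : p.degree < K := by
      rw [Finsupp.degree_eq_sum]
      have : ε * ((∑ i, p i : ℕ) : ℝ) < ε * K := hle.trans_lt hu
      exact_mod_cast lt_of_mul_lt_mul_left this hε.le
    rw [Finset.mem_coe, MvPolynomial.mem_support_iff, MvPowerSeries.coeff_truncTotal _ hdeg]
    exact hcoeff

theorem IsTaylorSeriesAtZero.exists_absSum_ne_top {m : ℕ} {F : (Fin m → ℂ) → ℂ}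
    {a : MvPowerSeries (Fin m) ℂ} (h : IsTaylorSeriesAtZero F a) :
    ∃ ρ : ℝ≥0∞, ρ ≠ 0 ∧ ρ ≠ ⊤ ∧ absSum a ρ ≠ ⊤ := by
  obtain ⟨r, hr, h⟩ := h
  have hnorm : ‖((r / 2 : ℝ) : ℂ)‖ = r / 2 := by
    rw [Complex.norm_real, Real.norm_of_nonneg (by positivity)]
  -- At a point with equal coordinates every monomial has absolute value `ρ ^ p.degree`, so absolute
  -- convergence there is finiteness of `absSum`.
  have hsum := (h (fun _ => ((r / 2 : ℝ) : ℂ)) fun _ => by rw [hnorm]; linarith).summable.norm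
  refine ⟨‖((r / 2 : ℝ) : ℂ)‖ₑ, ?_, enorm_ne_top, ?_⟩
  · rw [enorm_ne_zero]
    exact_mod_cast (by positivity : r / 2 ≠ 0)
  · have hne := hsum.tsum_ofReal_ne_top
    simp_rw [ofReal_norm] at hne
    refine ne_of_eq_of_ne (tsum_congr fun p => ?_) hne
    rw [enorm_mul, Finset.prod_pow_eq_pow_sum, enorm_pow, Finsupp.degree_eq_sum]

theorem IsTaylorSeriesAtZero.ne_zero {m : ℕ} {F : (Fin m → ℂ) → ℂ}
    {a : MvPowerSeries (Fin m) ℂ} (h : IsTaylorSeriesAtZero F a)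
    (hF : ¬ ∀ᶠ z in 𝓝 (0 : Fin m → ℂ), F z = 0) : a ≠ 0 := by
  rintro rfl
  obtain ⟨r, hr, h⟩ := h
  refine hF ?_
  filter_upwards [Metric.ball_mem_nhds (0 : Fin m → ℂ) hr] with z hz
  rw [mem_ball_zero_iff] at hz
  refine (h z fun i => (norm_le_pi_norm z i).trans_lt hz).unique ?_
  simp

/-! ### Uniform convergence on sectors -/

theorem norm_lt_of_mem_openSector {R α β : ℝ} {x : ℂ} (hx : x ∈ openSector R α β) :
    ‖x‖ < R := by
  obtain ⟨ρ, θ, hρ, hρR, -, -, rfl⟩ := hx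
  rwa [norm_mul, Complex.norm_exp_ofReal_mul_I, mul_one, Complex.norm_real,
    Real.norm_of_nonneg hρ.le]

/-- Absolute convergence at a positive number implies uniform convergence on sectors. -/
theorem GenPowerSeries.exists_tendstoUniformlyOn {φ : GenPowerSeries} {r : ℝ}
    (hφ : Summable fun k => ‖φ.coeff k‖ * r ^ φ.exponent k) {R α β : ℝ} (hR : R ≤ r)
    {L : ℂ → ℂ} (hL : IsLogBranchOn L (openSector R α β)) :
    ∃ f : ℂ → ℂ, TendstoUniformlyOn (φ.partialSum L) f atTop (openSector R α β) := by
  refine ⟨_, tendstoUniformlyOn_tsum_nat hφ fun k x hx => ?_⟩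
  -- The exponent is real, so only the real part of the logarithm matters, and it is the same for
  -- all branches.
  have hexp : ‖Complex.exp (φ.exponent k * L x)‖ = ‖x‖ ^ φ.exponent k := by
    rw [Complex.norm_exp, Complex.re_ofReal_mul, ← hL.2 x hx, Complex.norm_exp, hL.2 x hx,
      ← Real.exp_mul, mul_comm]
  rw [norm_mul, hexp]
  gcongr
  · exact (φ.exponent_pos k).le
  · exact (norm_lt_of_mem_openSector hx).le.trans hR

theorem GenPowerSeries.summable_of_absNorm_ne_top {φ : GenPowerSeries} {r : ℝ≥0∞}
    (h : φ.absNorm r ≠ ⊤) :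
    Summable fun k => ‖φ.coeff k‖ * r.toReal ^ φ.exponent k := by
  convert ENNReal.summable_toReal h using 2 with k
  rw [ENNReal.toReal_mul, ENNReal.toReal_rpow, toReal_enorm]
end

/-- A generalized power series with real exponents that formally satisfies an analytic Mahler
equation converges uniformly in every sector with vertex `0`, sufficiently small radius and
opening less than `2π`. -/
theorem mainTheorem7 (n l : ℕ) (hl : 2 ≤ l) (F : (Fin (n + 2) → ℂ) → ℂ)
    (hF : AnalyticAt ℂ F 0) (hF0 : ¬ ∀ᶠ z in 𝓝 (0 : Fin (n + 2) → ℂ), F z = 0)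
    (φ : GenPowerSeries) (hφ : IsFormalMahlerSolution n l hl F φ) :
    ∃ r : ℝ, 0 < r ∧ ∀ R α β : ℝ, R ≤ r → β - α < 2 * Real.pi →
      ∀ L : ℂ → ℂ, IsLogBranchOn L (openSector R α β) →
        ∃ f : ℂ → ℂ, TendstoUniformlyOn (φ.partialSum L) f atTop (openSector R α β) := by
  obtain ⟨a, ha, hsubst⟩ := hφ
  obtain ⟨ρ, hρ, hρt, haρ⟩ := ha.exists_absSum_ne_top
  -- A common lower bound for the exponents of all entries of the tuple, including the exponent `1`
  -- of `x`.
  set ε := min 1 (φ.exponent 0)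
  have hε : 0 < ε := lt_min one_pos φ.exponent_zero_pos
  have hmem : ∀ i, φ.mahlerTuple n l hl i ∈ hahnFilt ε := by
    intro i
    obtain ⟨j, rfl⟩ := (finRotate (n + 2)).surjective i
    have := congrFun (φ.mahlerTuple_comp_finRotate hl n) j
    rw [Function.comp_apply] at this
    rw [this]
    exact GenPowerSeries.hahnTuple_mem_hahnFilt hl (min_le_left _ _) _ φ (min_le_right _ _) j
  have hzero := isFormalZero_permute (finRotate (n + 2))
    (isFormalZero_of_substCoeff_eq_zero hε hmem hsubst)
  rw [φ.mahlerTuple_comp_finRotate hl n] at hzero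
  obtain ⟨r, hr0, hr1, hr⟩ := φ.exists_absNorm_ne_top hl hε (min_le_left _ _) (min_le_right _ _)
    (MvPowerSeries.permute_ne_zero _ (ha.ne_zero hF0)) hρ hρt
    (by rwa [absSum_permute]) hzero
  have hrpos : 0 < r.toReal :=
    ENNReal.toReal_pos hr0 (ne_top_of_le_ne_top ENNReal.one_ne_top hr1)
  exact ⟨r.toReal, hrpos, fun R α β hR _ L hL => GenPowerSeries.exists_tendstoUniformlyOn
    (GenPowerSeries.summable_of_absNorm_ne_top hr) hR hL⟩
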